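/- Let $H=\frac1{\sqrt2}\begin{pmatrix}1&1\\1&-1\end{pmatrix}$, $T=\mathrm{diag}(1,e^{i\pi/4})$ and $CZ=\mathrm{diag}(1,1,1,-1)$. There are a deterministic algorithm (a random access machine program whose time is measured by the logarithmic cost criterion), a polynomial $p$, and a function $\varepsilon(h)=o(h)$ such that the following holds. Given any $N\ge 0$, any quantum circuit $U$ on $N$ qubits consisting of $m$ gates, each an $H$, $T$ or $CZ$ gate, and any $a,b\in\{0,1\}^N$, the algorithm computes $\langle a|U|b\rangle$ exactly in time at most $$2^{0.984965\,h+\varepsilon(h)}+p(N+m),$$ where $h$ is the number of $H$ gates in $U$. The exact value is output as four integers $c_0,c_1,c_2,c_3$ with $$\langle a|U|b\rangle=\frac{1}{\sqrt{2}^{\,h}}\sum_{j=0}^{3}c_j\,e^{i\pi j/4}.$$ In particular, for circuits of size $m=\mathrm{poly}(N)$ the time is $2^{0.984965h+o(h)}+\mathrm{poly}(N)$, and it is $2^{0.984965h+o(h)}$ if moreover $N=2^{o(h)}$. -/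

import Mathlib

open Filter Asymptotics

/-! ### Quantum circuits over `H`, `T` and `CZ` -/

namespace QCirc

/-- The primitive eighth root of unity `exp (i π / 4)`. -/
noncomputable def omega : ℂ := Complex.exp (Complex.I * (Real.pi / 4))

/-- The Hadamard matrix. -/
noncomputable def hMat : Matrix (Fin 2) (Fin 2) ℂ :=
  ((1 / Real.sqrt 2 : ℝ) : ℂ) • !![1, 1; 1, -1]

/-- The `T` matrix. -/
noncomputable def tMat : Matrix (Fin 2) (Fin 2) ℂ := !![1, 0; 0, omega]

/-- Bit strings of length `N`: the labels of the computational basis of `N` qubits. -/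
abbrev Bits (N : ℕ) : Type := Fin N → Fin 2

/-- The one-qubit operator `M` on qubit `i`, tensored with the identity on the other qubits. -/
def onQubit {N : ℕ} (i : Fin N) (M : Matrix (Fin 2) (Fin 2) ℂ) :
    Matrix (Bits N) (Bits N) ℂ :=
  fun x y => if ∀ k, k ≠ i → x k = y k then M (x i) (y i) else 0

/-- The controlled-`Z` operator on qubits `i` and `j`. -/
def czMat {N : ℕ} (i j : Fin N) : Matrix (Bits N) (Bits N) ℂ :=
  Matrix.diagonal fun x => if x i = 1 ∧ x j = 1 then -1 else 1

/-- The gates on `N` qubits. The two qubits of a `CZ` are distinct. -/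
inductive Gate (N : ℕ) : Type
  | H (i : Fin N) : Gate N
  | T (i : Fin N) : Gate N
  | CZ (i j : Fin N) (hij : i ≠ j) : Gate N

/-- The unitary operator of a gate. -/
noncomputable def Gate.mat {N : ℕ} : Gate N → Matrix (Bits N) (Bits N) ℂ
  | .H i => onQubit i hMat
  | .T i => onQubit i tMat
  | .CZ i j _ => czMat i j

/-- Whether a gate is a Hadamard gate. -/
def Gate.isH {N : ℕ} : Gate N → Bool
  | .H _ => true
  | .T _ => false
  | .CZ _ _ _ => false

/-- A circuit is a list of gates; the head of the list acts first. Its size is its length. -/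
abbrev Circuit (N : ℕ) : Type := List (Gate N)

/-- The unitary operator of a circuit. -/
noncomputable def Circuit.mat {N : ℕ} : Circuit N → Matrix (Bits N) (Bits N) ℂ
  | [] => 1
  | g :: gs => Circuit.mat gs * g.mat

/-- The number of Hadamard gates of a circuit. -/
def Circuit.numH {N : ℕ} (U : Circuit N) : ℕ := U.countP Gate.isH

/-- The matrix element `⟨a|U|b⟩` in the computational basis. -/
noncomputable def Circuit.amplitude {N : ℕ} (U : Circuit N) (a b : Bits N) : ℂ := U.mat a b

/-- A gate as three integers: its kind and the qubits it acts on. -/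
def Gate.encode {N : ℕ} : Gate N → List ℤ
  | .H i => [0, ((i : ℕ) : ℤ), 0]
  | .T i => [1, ((i : ℕ) : ℤ), 0]
  | .CZ i j _ => [2, ((i : ℕ) : ℤ), ((j : ℕ) : ℤ)]

/-- A bit string as a list of integers `0` and `1`. -/
def encodeBits {N : ℕ} (a : Bits N) : List ℤ := List.ofFn fun i => (((a i : Fin 2) : ℕ) : ℤ)

/-- The description of an instance that an algorithm receives: the number of qubits, the number
of gates, the two bit strings and the gates in order. -/
def encodeInput {N : ℕ} (U : Circuit N) (a b : Bits N) : List ℤ :=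
  [(N : ℤ), (U.length : ℤ)] ++ encodeBits a ++ encodeBits b ++ U.flatMap Gate.encode

end QCirc

/-! ### Deterministic random access machines with logarithmic cost -/

namespace RAM

/-- A state of the machine: registers, which a program names directly, and a memory, which is
accessed indirectly through addresses held in registers. Both hold integers. -/
structure State where
  reg : ℕ → ℤ
  mem : ℕ → ℤ

/-- Write the value `v` to register `i`. -/
def State.setReg (s : State) (i : ℕ) (v : ℤ) : State :=
  ⟨Function.update s.reg i v, s.mem⟩

/-- Write the value `v` to the memory cell with address `n`. -/
def State.setMem (s : State) (n : ℕ) (v : ℤ) : State :=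
  ⟨s.reg, Function.update s.mem n v⟩

/-- The start state: the input occupies an initial segment of the memory; everything else is
`0`. -/
def State.init (input : List ℤ) : State := ⟨fun _ => 0, fun n => input.getD n 0⟩

/-- The arithmetic operations. Division and remainder are Euclidean. -/
inductive Op : Type
  | add | sub | mul | div | mod

/-- The value of an arithmetic operation. -/
def Op.eval : Op → ℤ → ℤ → ℤ
  | .add, x, y => x + y
  | .sub, x, y => x - y
  | .mul, x, y => x * y
  | .div, x, y => x / y
  | .mod, x, y => x % y

/-- The length of an integer: sign bit and binary digits. -/
def len (z : ℤ) : ℕ := z.natAbs.size + 1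

/-- The cost of an arithmetic operation: linear in the lengths of the operands for sums and
differences, and the product of the lengths for the other operations. -/
def Op.cost : Op → ℤ → ℤ → ℕ
  | .add, x, y => len x + len y
  | .sub, x, y => len x + len y
  | .mul, x, y => len x * len y
  | .div, x, y => len x * len y
  | .mod, x, y => len x * len y

/-- Programs. The tests of `cond` and `loop` ask whether a register is positive. -/
inductive Prog : Type
  /-- do nothing -/
  | skip : Prog
  /-- `r i := c` -/
  | const (i : ℕ) (c : ℤ) : Prog
  /-- `r i := r j` -/
  | move (i j : ℕ) : Prog
  /-- `r i := o (r j) (r k)` -/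
  | arith (o : Op) (i j k : ℕ) : Prog
  /-- `r i := M[r j]` -/
  | load (i j : ℕ) : Prog
  /-- `M[r i] := r j` -/
  | store (i j : ℕ) : Prog
  /-- `p`, then `q` -/
  | seq (p q : Prog) : Prog
  /-- `p` if `r i` is positive, else `q` -/
  | cond (i : ℕ) (p q : Prog) : Prog
  /-- repeat `p` as long as `r i` is positive -/
  | loop (i : ℕ) (p : Prog) : Prog

/-- `Exec p s t s'`: the program `p`, started in the state `s`, halts in the state `s'` after
time `t`. Every elementary step is charged the lengths of the integers it handles, addresses
included. -/
inductive Exec : Prog → State → ℕ → State → Prop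
  | skip (s : State) : Exec .skip s 1 s
  | const (i : ℕ) (c : ℤ) (s : State) : Exec (.const i c) s (len c) (s.setReg i c)
  | move (i j : ℕ) (s : State) : Exec (.move i j) s (len (s.reg j)) (s.setReg i (s.reg j))
  | arith (o : Op) (i j k : ℕ) (s : State) :
      Exec (.arith o i j k) s (o.cost (s.reg j) (s.reg k))
        (s.setReg i (o.eval (s.reg j) (s.reg k)))
  | load (i j : ℕ) (s : State) :
      Exec (.load i j) s (len (s.reg j) + len (s.mem (s.reg j).toNat))
        (s.setReg i (s.mem (s.reg j).toNat))
  | store (i j : ℕ) (s : State) :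
      Exec (.store i j) s (len (s.reg i) + len (s.reg j))
        (s.setMem (s.reg i).toNat (s.reg j))
  | seq {p q : Prog} {s s' s'' : State} {t t' : ℕ} (hp : Exec p s t s') (hq : Exec q s' t' s'') :
      Exec (.seq p q) s (t + t') s''
  | condPos {i : ℕ} {p q : Prog} {s s' : State} {t : ℕ} (hi : 0 < s.reg i) (hp : Exec p s t s') :
      Exec (.cond i p q) s (len (s.reg i) + t) s'
  | condNonpos {i : ℕ} {p q : Prog} {s s' : State} {t : ℕ} (hi : s.reg i ≤ 0)
      (hq : Exec q s t s') : Exec (.cond i p q) s (len (s.reg i) + t) s'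
  | loopPos {i : ℕ} {p : Prog} {s s' s'' : State} {t t' : ℕ} (hi : 0 < s.reg i)
      (hp : Exec p s t s') (hl : Exec (.loop i p) s' t' s'') :
      Exec (.loop i p) s (len (s.reg i) + t + t') s''
  | loopNonpos {i : ℕ} {p : Prog} {s : State} (hi : s.reg i ≤ 0) :
      Exec (.loop i p) s (len (s.reg i)) s

/-- The machine is deterministic: a halting run determines its time and its final state. -/
theorem Exec.deterministic {p : Prog} {s s₁ s₂ : State} {t₁ t₂ : ℕ}
    (h₁ : Exec p s t₁ s₁) (h₂ : Exec p s t₂ s₂) : t₁ = t₂ ∧ s₁ = s₂ := by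
  induction h₁ generalizing t₂ s₂ with
  | skip | const | move | arith | load | store => cases h₂; exact ⟨rfl, rfl⟩
  | seq _ _ ihp ihq =>
    cases h₂ with
    | seq hp hq =>
      obtain ⟨rfl, rfl⟩ := ihp hp
      obtain ⟨rfl, rfl⟩ := ihq hq
      exact ⟨rfl, rfl⟩
  | condPos hi _ ih =>
    cases h₂ with
    | condPos _ hp => obtain ⟨rfl, rfl⟩ := ih hp; exact ⟨rfl, rfl⟩
    | condNonpos hi' _ => omega
  | condNonpos hi _ ih =>
    cases h₂ with
    | condPos hi' _ => omega
    | condNonpos _ hq => obtain ⟨rfl, rfl⟩ := ih hq; exact ⟨rfl, rfl⟩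
  | loopPos hi _ _ ihp ihl =>
    cases h₂ with
    | loopPos _ hp hl =>
      obtain ⟨rfl, rfl⟩ := ihp hp
      obtain ⟨rfl, rfl⟩ := ihl hl
      exact ⟨rfl, rfl⟩
    | loopNonpos hi' => omega
  | loopNonpos hi =>
    cases h₂ with
    | loopPos hi' _ _ => omega
    | loopNonpos _ => exact ⟨rfl, rfl⟩

end RAM

/-! The method is meeting in the middle. After scaling by `√2`, every entry of `H` is a sign, and
`T` and `CZ` are diagonal with powers of `omega` as entries. So `√2 ^ h ⟨s'|U|s⟩` is a sum of powers
of `omega` over the `2 ^ h` computational paths that start at `s` and end at `s'`; each Hadamard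
gate gives one binary choice (`sum_paths`).

Cut the circuit as `V ++ V'` with the Hadamard gates shared as evenly as possible. Follow all paths
through `V` from `b` and count in a table how many end in each pair (bit string, phase). All gates
are symmetric matrices, so the reversed `V'` has the transposed matrix (`Circuit.mat_reverse`), and
paths through it from `a` can be joined to the forward paths by looking up their end points.
Counting the joined pairs by total phase mod 8 gives eight numbers, and `omega ^ 4 = -1` folds them
into the four coefficients (`sum_pairCount`, `amplitude_append`).

The table is indexed directly by the encoded outcome. Its addresses may be exponential in `N`, but
they have only `O(N)` digits, and unused cells are `0` at no cost. The time is therefore at most `E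
* 2 ^ (h / 2)` with `E` polynomial in `N + m` (`runs_amplitudeProg`, `two_pow_add_le`). Either `E`
is at most `2 ^ (0.4 h)`, which leaves an exponent of at most `0.9 h`, or `2 ^ (h / 2)` is at most
`E ^ 2` (`mul_two_rpow_half_le`). Hence `ε = 0` suffices, and the exponent `0.984965` is far from
tight for this machine model.

For the machine, loop-free programs are evaluated symbolically, with a time bound quadratic in the
lengths of the integers in the state (`Prog.Straight.runs`); the loops are handled by induction. -/

namespace RAM

/-! ### Loop-free programs and their running time -/

/-- The program contains no loop and names only registers below `n`. -/
def Prog.Straight (n : ℕ) : Prog → Prop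
  | .skip => True
  | .const i _ => i < n
  | .move i j => i < n ∧ j < n
  | .arith _ i j k => i < n ∧ j < n ∧ k < n
  | .load i j => i < n ∧ j < n
  | .store i j => i < n ∧ j < n
  | .seq p q => p.Straight n ∧ q.Straight n
  | .cond i p q => i < n ∧ p.Straight n ∧ q.Straight n
  | .loop _ _ => False

instance Prog.Straight.decidable (n : ℕ) : (P : Prog) → Decidable (P.Straight n)
  | .skip => isTrue trivial
  | .const i _ => inferInstanceAs (Decidable (i < n))
  | .move i j => inferInstanceAs (Decidable (i < n ∧ j < n))
  | .arith _ i j k => inferInstanceAs (Decidable (i < n ∧ j < n ∧ k < n))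
  | .load i j => inferInstanceAs (Decidable (i < n ∧ j < n))
  | .store i j => inferInstanceAs (Decidable (i < n ∧ j < n))
  | .seq p q => @instDecidableAnd _ _ (Prog.Straight.decidable n p) (Prog.Straight.decidable n q)
  | .cond i p q =>
    @instDecidableAnd _ _ (inferInstanceAs (Decidable (i < n)))
      (@instDecidableAnd _ _ (Prog.Straight.decidable n p) (Prog.Straight.decidable n q))
  | .loop _ _ => isFalse id

/-- The effect of a loop-free program on a list of registers and the memory. -/
def Prog.eval : Prog → List ℤ × (ℕ → ℤ) → List ℤ × (ℕ → ℤ)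
  | .skip, x => x
  | .const i c, x => (x.1.set i c, x.2)
  | .move i j, x => (x.1.set i (x.1.getD j 0), x.2)
  | .arith o i j k, x => (x.1.set i (o.eval (x.1.getD j 0) (x.1.getD k 0)), x.2)
  | .load i j, x => (x.1.set i (x.2 (x.1.getD j 0).toNat), x.2)
  | .store i j, x => (x.1, Function.update x.2 (x.1.getD i 0).toNat (x.1.getD j 0))
  | .seq p q, x => q.eval (p.eval x)
  | .cond i p q, x => if 0 < x.1.getD i 0 then p.eval x else q.eval x
  | .loop _ _, x => x

/-- The state whose first registers are listed, the others being `0`. -/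
def State.mk' (x : List ℤ × (ℕ → ℤ)) : State := ⟨fun i => x.1.getD i 0, x.2⟩

/-- All registers and memory cells have length at most `W`. -/
def Bounded (W : ℕ) (x : List ℤ × (ℕ → ℤ)) : Prop :=
  (∀ v ∈ x.1, len v ≤ W) ∧ ∀ n, len (x.2 n) ≤ W

/-- A factor by which a loop-free program can multiply the lengths of the integers in a state. -/
def Prog.growth : Prog → ℕ
  | .const _ c => len c
  | .arith _ _ _ _ => 2
  | .seq p q => p.growth * q.growth
  | .cond _ p q => p.growth * q.growth
  | .skip | .move _ _ | .load _ _ | .store _ _ | .loop _ _ => 1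

/-- The factor in the quadratic time bound for a loop-free program. -/
def Prog.costFactor : Prog → ℕ
  | .skip => 1
  | .const _ c => len c
  | .move _ _ => 1
  | .arith _ _ _ _ => 2
  | .load _ _ => 2
  | .store _ _ => 2
  | .seq p q => p.costFactor + q.costFactor * p.growth ^ 2
  | .cond _ p q => 1 + p.costFactor + q.costFactor
  | .loop _ _ => 1

theorem len_pos (z : ℤ) : 1 ≤ len z := Nat.le_add_left _ _

theorem len_le_iff {z : ℤ} {w : ℕ} : len z ≤ w + 1 ↔ |z| < 2 ^ w := by
  rw [len, Nat.add_le_add_iff_right, Nat.size_le, Int.abs_eq_natAbs]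
  exact_mod_cast Iff.rfl

theorem len_le_of_natAbs_le {y z : ℤ} (h : y.natAbs ≤ z.natAbs) : len y ≤ len z :=
  Nat.add_le_add_right (Nat.size_le_size h) 1

theorem len_add_le (x y : ℤ) : len (x + y) ≤ max (len x) (len y) + 1 := by
  obtain ⟨u, hu⟩ : ∃ u, max (len x) (len y) = u + 1 :=
    ⟨_, (Nat.sub_add_cancel ((len_pos x).trans (le_max_left _ _))).symm⟩
  have hx : |x| < 2 ^ u := len_le_iff.1 (hu ▸ le_max_left _ _)
  have hy : |y| < 2 ^ u := len_le_iff.1 (hu ▸ le_max_right _ _)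
  rw [hu]
  refine len_le_iff.2 ((abs_add_le x y).trans_lt ?_)
  rw [pow_succ]
  linarith

theorem len_neg (x : ℤ) : len (-x) = len x := by simp [len]

theorem len_mul_le (x y : ℤ) : len (x * y) ≤ len x + len y := by
  have hx : |x| < 2 ^ (x.natAbs.size) := len_le_iff.1 le_rfl
  have hy : |y| < 2 ^ (y.natAbs.size) := len_le_iff.1 le_rfl
  have : len (x * y) ≤ x.natAbs.size + y.natAbs.size + 1 := by
    refine len_le_iff.2 ?_
    rw [abs_mul, pow_add]
    exact mul_lt_mul'' hx hy (abs_nonneg _) (abs_nonneg _)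
  unfold len at *
  omega

theorem len_ediv_le (x y : ℤ) : len (x / y) ≤ len x :=
  len_le_of_natAbs_le (Int.natAbs_ediv_le_natAbs x y)

theorem len_emod_le (x y : ℤ) : len (x % y) ≤ max (len x) (len y) := by
  rcases eq_or_ne y 0 with rfl | hy
  · simp
  · refine (len_le_of_natAbs_le ?_).trans (le_max_right _ _)
    have h1 := Int.emod_nonneg x hy
    have h2 := Int.emod_lt_abs x hy
    rw [Int.abs_eq_natAbs] at h2
    omega

/-- The factor 2 is needed for products, whose lengths add. For sums and differences it absorbs the
carry, because lengths are at least 1. -/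
theorem Op.len_eval_le (o : Op) {x y : ℤ} {W : ℕ} (hx : len x ≤ W) (hy : len y ≤ W) :
    len (o.eval x y) ≤ 2 * W := by
  have h1 := len_pos x
  cases o with
  | add => have := len_add_le x y; simp only [Op.eval]; omega
  | sub =>
    have := len_add_le x (-y)
    rw [len_neg, ← sub_eq_add_neg] at this
    simp only [Op.eval]; omega
  | mul => have := len_mul_le x y; simp only [Op.eval]; omega
  | div => have := len_ediv_le x y; simp only [Op.eval]; omega
  | mod => have := len_emod_le x y; simp only [Op.eval]; omega

theorem Op.cost_le (o : Op) {x y : ℤ} {W : ℕ} (hx : len x ≤ W) (hy : len y ≤ W) :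
    o.cost x y ≤ 2 * W ^ 2 := by
  have h1 := len_pos x
  have h2 : len x * len y ≤ W ^ 2 := by rw [pow_two]; exact Nat.mul_le_mul hx hy
  have h3 : W ≤ W ^ 2 := Nat.le_self_pow two_ne_zero W
  cases o <;> simp only [Op.cost] <;> omega

theorem Bounded.mono {W W' : ℕ} {x : List ℤ × (ℕ → ℤ)} (h : Bounded W x) (hW : W ≤ W') :
    Bounded W' x :=
  ⟨fun v hv => (h.1 v hv).trans hW, fun n => (h.2 n).trans hW⟩

theorem Bounded.len_getD_le {W : ℕ} {x : List ℤ × (ℕ → ℤ)} (h : Bounded W x) (hW : 1 ≤ W)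
    (i : ℕ) : len (x.1.getD i 0) ≤ W := by
  rcases lt_or_ge i x.1.length with hi | hi
  · rw [List.getD_eq_getElem _ _ hi]
    exact h.1 _ (List.getElem_mem hi)
  · rw [List.getD_eq_default _ _ hi]
    exact hW

theorem Bounded.set {W : ℕ} {x : List ℤ × (ℕ → ℤ)} (h : Bounded W x) {v : ℤ} (hv : len v ≤ W)
    (i : ℕ) : Bounded W (x.1.set i v, x.2) := by
  refine ⟨fun u hu => ?_, h.2⟩
  rcases List.mem_or_eq_of_mem_set hu with hu | rfl
  · exact h.1 _ hu
  · exact hv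

theorem Bounded.update {W : ℕ} {x : List ℤ × (ℕ → ℤ)} (h : Bounded W x) {v : ℤ}
    (hv : len v ≤ W) (n : ℕ) : Bounded W (x.1, Function.update x.2 n v) := by
  refine ⟨h.1, fun k => ?_⟩
  rcases eq_or_ne k n with rfl | hk
  · simpa using hv
  · simpa [hk] using h.2 k

theorem Prog.growth_pos : ∀ P : Prog, 1 ≤ P.growth
  | .skip | .move _ _ | .load _ _ | .store _ _ | .loop _ _ => le_rfl
  | .const _ c => len_pos c
  | .arith _ _ _ _ => one_le_two
  | .seq p q => Nat.mul_pos p.growth_pos q.growth_pos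
  | .cond _ p q => Nat.mul_pos p.growth_pos q.growth_pos

theorem Prog.length_eval (P : Prog) (x : List ℤ × (ℕ → ℤ)) :
    (P.eval x).1.length = x.1.length := by
  induction P generalizing x with
  | seq p q ihp ihq => rw [Prog.eval, ihq, ihp]
  | cond i p q ihp ihq => rw [Prog.eval]; split_ifs <;> simp only [ihp, ihq]
  | _ => simp [Prog.eval]

theorem Prog.bounded_eval (P : Prog) {x : List ℤ × (ℕ → ℤ)} {W : ℕ} (hW : 1 ≤ W)
    (h : Bounded W x) : Bounded (P.growth * W) (P.eval x) := by
  induction P generalizing x W with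
  | skip => simpa [Prog.growth, Prog.eval] using h
  | const i c =>
    exact (h.mono (Nat.le_mul_of_pos_left _ (len_pos c))).set (Nat.le_mul_of_pos_right _ hW) i
  | move i j => rw [Prog.growth, one_mul]; exact h.set (h.len_getD_le hW j) i
  | arith o i j k =>
    exact (h.mono (Nat.le_mul_of_pos_left _ two_pos)).set
      (o.len_eval_le (h.len_getD_le hW j) (h.len_getD_le hW k)) i
  | load i j => rw [Prog.growth, one_mul]; exact h.set (h.2 _) i
  | store i j => rw [Prog.growth, one_mul]; exact h.update (h.len_getD_le hW j) _
  | seq p q ihp ihq =>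
    rw [Prog.growth, mul_comm p.growth, mul_assoc]
    exact ihq (Nat.mul_pos p.growth_pos hW) (ihp hW h)
  | cond i p q ihp ihq =>
    rw [Prog.growth, Prog.eval]
    split_ifs
    -- Both growth factors are at least 1, so their product dominates whichever branch is taken.
    · exact (ihp hW h).mono (Nat.mul_le_mul_right _ (Nat.le_mul_of_pos_right _ q.growth_pos))
    · exact (ihq hW h).mono (Nat.mul_le_mul_right _ (Nat.le_mul_of_pos_left _ p.growth_pos))
  | loop i p => simpa [Prog.growth, Prog.eval] using h

/-- `List.set` does nothing beyond the end of the list, whence the bound on `i`. This is why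
`Prog.Straight` limits the register names. -/
theorem State.setReg_mk' {x : List ℤ × (ℕ → ℤ)} {i : ℕ} (hi : i < x.1.length) (v : ℤ) :
    (State.mk' x).setReg i v = State.mk' (x.1.set i v, x.2) := by
  simp only [State.setReg, State.mk', State.mk.injEq, and_true]
  funext k
  rcases eq_or_ne k i with rfl | hk
  · simp [List.getD, hi]
  · simp [List.getD, hk, hk.symm]

/-- `Runs P x y T`: started in the state `x`, the program `P` halts in `y` after time at most
`T`. -/
def Runs (P : Prog) (x y : List ℤ × (ℕ → ℤ)) (T : ℕ) : Prop :=
  ∃ t ≤ T, Exec P (State.mk' x) t (State.mk' y)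

theorem Runs.mono {P : Prog} {x y : List ℤ × (ℕ → ℤ)} {T T' : ℕ} (h : Runs P x y T)
    (hT : T ≤ T') : Runs P x y T' :=
  let ⟨t, ht, he⟩ := h
  ⟨t, ht.trans hT, he⟩

theorem Runs.seq {P Q : Prog} {x y z : List ℤ × (ℕ → ℤ)} {T T' : ℕ} (h : Runs P x y T)
    (h' : Runs Q y z T') : Runs (.seq P Q) x z (T + T') :=
  let ⟨_, ht, he⟩ := h
  let ⟨_, ht', he'⟩ := h'
  ⟨_, add_le_add ht ht', .seq he he'⟩

/-- Each instruction costs at most quadratically in the current lengths. In a sequence the second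
program starts from lengths up to `p.growth * W`, which explains the square of the growth in
`costFactor`. -/
theorem Prog.Straight.runs {P : Prog} {x : List ℤ × (ℕ → ℤ)} {W : ℕ}
    (hP : P.Straight x.1.length) (hW : 1 ≤ W) (h : Bounded W x) :
    Runs P x (P.eval x) (P.costFactor * W ^ 2) := by
  have hWW : W ≤ W ^ 2 := Nat.le_self_pow two_ne_zero W
  have hreg (j : ℕ) : (State.mk' x).reg j = x.1.getD j 0 := rfl
  induction P generalizing x W with
  | skip => exact ⟨1, by simp only [Prog.costFactor]; omega, .skip _⟩
  | const i c =>
    refine ⟨len c, Nat.le_mul_of_pos_right _ (by omega), ?_⟩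
    rw [Prog.eval, ← State.setReg_mk' hP]
    exact .const i c _
  | move i j =>
    refine ⟨len (x.1.getD j 0), ?_, ?_⟩
    · have := h.len_getD_le hW j
      rw [Prog.costFactor]
      omega
    · rw [Prog.eval, ← State.setReg_mk' hP.1]
      exact .move i j _
  | arith o i j k =>
    refine ⟨o.cost (x.1.getD j 0) (x.1.getD k 0),
      o.cost_le (h.len_getD_le hW j) (h.len_getD_le hW k), ?_⟩
    rw [Prog.eval, ← State.setReg_mk' hP.1]
    exact .arith o i j k _
  | load i j =>
    refine ⟨len (x.1.getD j 0) + len (x.2 (x.1.getD j 0).toNat), ?_, ?_⟩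
    · have h1 := h.len_getD_le hW j
      have h2 := h.2 (x.1.getD j 0).toNat
      rw [Prog.costFactor]
      omega
    · rw [Prog.eval, ← State.setReg_mk' hP.1]
      exact .load i j _
  | store i j =>
    refine ⟨_, ?_, .store i j _⟩
    have h1 := h.len_getD_le hW i
    have h2 := h.len_getD_le hW j
    rw [hreg, hreg, Prog.costFactor]
    omega
  | seq p q ihp ihq =>
    have h1 := ihp hP.1 hW h hWW hreg
    have h2 := ihq (x := p.eval x) (by rw [p.length_eval]; exact hP.2)
      (Nat.mul_pos p.growth_pos hW) (p.bounded_eval hW h) (Nat.le_self_pow two_ne_zero _)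
      (fun _ => rfl)
    refine (h1.seq h2).mono (le_of_eq ?_)
    rw [Prog.costFactor]
    ring
  | cond i p q ihp ihq =>
    have h1 := h.len_getD_le hW i
    rw [Prog.eval, Prog.costFactor, add_mul, add_mul, one_mul]
    split_ifs with hi
    · obtain ⟨t, ht, he⟩ := ihp hP.2.1 hW h hWW hreg
      refine ⟨_, ?_, .condPos hi he⟩
      rw [hreg]
      omega
    · obtain ⟨t, ht, he⟩ := ihq hP.2.2 hW h hWW hreg
      refine ⟨_, ?_, .condNonpos (not_lt.1 hi) he⟩
      rw [hreg]
      omega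
  | loop i p => exact hP.elim

theorem Runs.straight {P : Prog} {x y : List ℤ × (ℕ → ℤ)} {n W : ℕ} (hP : P.Straight n)
    (hx : x.1.length = n) (hW : 1 ≤ W) (h : Bounded W x) (hy : P.eval x = y) :
    Runs P x y (P.costFactor * W ^ 2) := by
  subst hx hy
  exact hP.runs hW h

theorem Runs.loop_pos {i : ℕ} {P : Prog} {x y z : List ℤ × (ℕ → ℤ)} {T T' W : ℕ}
    (hi : 0 < x.1.getD i 0) (hW : len (x.1.getD i 0) ≤ W) (h : Runs P x y T)
    (h' : Runs (.loop i P) y z T') : Runs (.loop i P) x z (W + T + T') :=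
  let ⟨_, ht, he⟩ := h
  let ⟨_, ht', he'⟩ := h'
  ⟨_, add_le_add (add_le_add hW ht) ht', .loopPos hi he he'⟩

theorem Runs.loop_nonpos {i : ℕ} {P : Prog} {x : List ℤ × (ℕ → ℤ)} {W : ℕ}
    (hi : x.1.getD i 0 ≤ 0) (hW : len (x.1.getD i 0) ≤ W) : Runs (.loop i P) x x W :=
  ⟨_, hW, .loopNonpos hi⟩

end RAM

namespace QCirc

/-! ### Path sums -/

/-- Division with remainder is a bijection from numbers below `c * K` to pairs. It is used with `c =
2` to split off a branch bit and with `c = 8` to split off a phase. -/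
theorem sum_range_mul_mod_div {α : Type*} [AddCommMonoid α] {c : ℕ} (hc : 0 < c) (K : ℕ)
    (f : ℕ → ℕ → α) :
    ∑ w ∈ Finset.range (c * K), f (w % c) (w / c) =
      ∑ z ∈ Finset.range K, ∑ r ∈ Finset.range c, f r z := by
  induction K with
  | zero => simp
  | succ K ih =>
    rw [Nat.mul_succ, Finset.sum_range_add, ih, Finset.sum_range_succ]
    congr 1
    refine Finset.sum_congr rfl fun r hr => ?_
    have hr := Finset.mem_range.1 hr
    rw [Nat.mul_add_mod, Nat.mod_eq_of_lt hr, Nat.mul_add_div hc, Nat.div_eq_of_lt hr, add_zero]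

theorem omega_pow_four : omega ^ 4 = -1 := by
  rw [omega, ← Complex.exp_nat_mul, ← Complex.exp_pi_mul_I]
  congr 1
  push_cast
  ring

theorem omega_pow_eight : omega ^ 8 = 1 := by
  rw [show 8 = 4 * 2 from rfl, pow_mul, omega_pow_four]
  norm_num

theorem omega_pow_mod (k : ℕ) : omega ^ (k % 8) = omega ^ k := by
  conv_rhs => rw [← Nat.div_add_mod k 8, pow_add, pow_mul, omega_pow_eight, one_pow, one_mul]

/-- A bit string as a number. -/
def enc {N : ℕ} (s : Bits N) : ℕ := finFunctionFinEquiv s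

theorem enc_eq_sum {N : ℕ} (s : Bits N) : enc s = ∑ i, (s i : ℕ) * 2 ^ (i : ℕ) :=
  finFunctionFinEquiv_apply s

theorem enc_lt {N : ℕ} (s : Bits N) : enc s < 2 ^ N := (finFunctionFinEquiv s).2

theorem enc_injective {N : ℕ} : Function.Injective (enc (N := N)) :=
  Fin.val_injective.comp finFunctionFinEquiv.injective

theorem enc_div_mod {N : ℕ} (s : Bits N) (i : Fin N) : enc s / 2 ^ (i : ℕ) % 2 = s i := by
  have := congrFun (finFunctionFinEquiv.symm_apply_apply s) i
  rw [← this]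
  rfl

/-- This is the form in which the program changes a bit: it adds a signed multiple of a power of
two. -/
theorem enc_update {N : ℕ} (s : Bits N) (i : Fin N) (v : Fin 2) :
    (enc (Function.update s i v) : ℤ) = enc s + ((v : ℕ) - (s i : ℕ)) * 2 ^ (i : ℕ) := by
  rw [enc_eq_sum, enc_eq_sum, ← Finset.add_sum_erase _ _ (Finset.mem_univ i),
    ← Finset.add_sum_erase (a := i) _ (fun i => (s i : ℕ) * 2 ^ (i : ℕ)) (Finset.mem_univ i)]
  rw [Finset.sum_congr rfl (g := fun i => (s i : ℕ) * 2 ^ (i : ℕ)) fun k hk => by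
    rw [Function.update_of_ne (Finset.ne_of_mem_erase hk)]]
  rw [Function.update_self]
  push_cast
  ring

/-- One gate along a computational path. The components are the bits that choose the branches of
the Hadamard gates still to come, the current bit string, and the phase as a power of `omega`. -/
def Gate.step {N : ℕ} (x : ℕ × Bits N × ℕ) : Gate N → ℕ × Bits N × ℕ
  | .H i => (x.1 / 2, Function.update x.2.1 i (Fin.ofNat 2 x.1),
      (x.2.2 + 4 * ((x.2.1 i : ℕ) * (x.1 % 2))) % 8)
  | .T i => (x.1, x.2.1, (x.2.2 + (x.2.1 i : ℕ)) % 8)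
  | .CZ i j _ => (x.1, x.2.1, (x.2.2 + 4 * ((x.2.1 i : ℕ) * (x.2.1 j : ℕ))) % 8)

/-- A circuit along a computational path. -/
def Circuit.run {N : ℕ} (U : Circuit N) (x : ℕ × Bits N × ℕ) : ℕ × Bits N × ℕ :=
  U.foldl Gate.step x

theorem Circuit.run_cons {N : ℕ} (g : Gate N) (U : Circuit N) (x : ℕ × Bits N × ℕ) :
    Circuit.run (g :: U) x = Circuit.run U (g.step x) := rfl

theorem Gate.step_phase_lt {N : ℕ} (g : Gate N) (x : ℕ × Bits N × ℕ) : (g.step x).2.2 < 8 := by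
  cases g <;> exact Nat.mod_lt _ (by norm_num)

theorem Gate.step_path_le {N : ℕ} (g : Gate N) (x : ℕ × Bits N × ℕ) : (g.step x).1 ≤ x.1 := by
  cases g
  · exact Nat.div_le_self _ _
  · exact le_rfl
  · exact le_rfl

theorem Circuit.run_path_le {N : ℕ} (U : Circuit N) (x : ℕ × Bits N × ℕ) : (U.run x).1 ≤ x.1 := by
  induction U generalizing x with
  | nil => exact le_rfl
  | cons g U ih => exact (ih (g.step x)).trans (g.step_path_le x)

theorem Circuit.run_phase_lt {N : ℕ} (U : Circuit N) {x : ℕ × Bits N × ℕ} (hx : x.2.2 < 8) :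
    (U.run x).2.2 < 8 := by
  induction U generalizing x with
  | nil => exact hx
  | cons g U ih => exact ih (g.step_phase_lt x)

theorem Circuit.numH_cons {N : ℕ} (g : Gate N) (U : Circuit N) :
    Circuit.numH (g :: U) = U.numH + if g.isH then 1 else 0 :=
  List.countP_cons ..

theorem Circuit.numH_le {N : ℕ} (U : Circuit N) : U.numH ≤ U.length := List.countP_le_length

theorem Circuit.numH_append {N : ℕ} (U V : Circuit N) :
    Circuit.numH (U ++ V) = U.numH + V.numH := List.countP_append

theorem Circuit.numH_reverse {N : ℕ} (U : Circuit N) :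
    Circuit.numH (List.reverse U) = U.numH := List.countP_reverse

/-- The column at `s` is supported on the strings that agree with `s` off qubit `i`, and these are
the two updates of `s` at `i`. -/
theorem sum_mul_onQubit {N : ℕ} (i : Fin N) (M : Matrix (Fin 2) (Fin 2) ℂ) (s : Bits N)
    (F : Bits N → ℂ) :
    ∑ c, F c * onQubit i M c s = ∑ v, F (Function.update s i v) * M v (s i) := by
  simp only [onQubit, mul_ite, mul_zero]
  rw [← Finset.sum_filter]
  refine Finset.sum_nbij' (fun c => c i) (fun v => Function.update s i v) (by simp) ?_ ?_ ?_ ?_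
  · intro v _
    simp only [Finset.mem_filter, Finset.mem_univ, true_and]
    exact fun k hk => Function.update_of_ne hk _ _
  · intro c hc
    have hc := (Finset.mem_filter.1 hc).2
    funext k
    rcases eq_or_ne k i with rfl | hk
    · simp
    · simp [hk, hc k hk]
  · intro v _
    simp
  · intro c hc
    have hc := (Finset.mem_filter.1 hc).2
    congr 2
    funext k
    rcases eq_or_ne k i with rfl | hk
    · simp
    · simp [hk, hc k hk]

theorem sqrt_two_mul_hMat (u v : Fin 2) :
    ((Real.sqrt 2 : ℝ) : ℂ) * hMat v u = omega ^ (4 * ((u : ℕ) * (v : ℕ))) := by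
  have h : ((Real.sqrt 2 : ℝ) : ℂ) ≠ 0 := by simp
  rw [pow_mul, omega_pow_four]
  fin_cases u <;> fin_cases v <;> simp [hMat, h]

/-- Induction on the circuit, peeling off the gate that acts first. At an `H` the lowest bit of `z`
is the new value of the qubit and `z / 2` drives the remaining gates; the two branches are the two
terms of the matrix product. The other gates are diagonal and only change the phase. A general
initial phase `ph` is needed for the induction and again for the backward paths. -/
theorem sum_paths {N : ℕ} (U : Circuit N) (s s' : Bits N) (ph : ℕ) :
    ∑ z ∈ Finset.range (2 ^ U.numH),
        (if (U.run (z, s, ph)).2.1 = s' then omega ^ (U.run (z, s, ph)).2.2 else 0) =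
      omega ^ ph * ((Real.sqrt 2 : ℝ) : ℂ) ^ U.numH * U.mat s' s := by
  induction U generalizing s ph with
  | nil => simp [Circuit.numH, Circuit.run, Circuit.mat, Matrix.one_apply, eq_comm]
  | cons g U ih =>
    rw [Circuit.mat, Matrix.mul_apply, Circuit.numH_cons]
    cases g with
    | H i =>
      simp only [Gate.isH, if_true, Gate.mat, sum_mul_onQubit]
      rw [pow_succ' 2]
      have key := sum_range_mul_mod_div (c := 2) two_pos (2 ^ Circuit.numH U) (fun c z =>
        if (Circuit.run U (z, Function.update s i (Fin.ofNat 2 c),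
            (ph + 4 * ((s i : ℕ) * (c % 2))) % 8)).2.1 = s' then
          omega ^ (Circuit.run U (z, Function.update s i (Fin.ofNat 2 c),
            (ph + 4 * ((s i : ℕ) * (c % 2))) % 8)).2.2 else 0)
      refine Eq.trans (Finset.sum_congr rfl fun w _ => ?_) (key.trans ?_)
      · have hmod : Fin.ofNat 2 (w % 2) = Fin.ofNat 2 w := by ext; simp
        simp only [hmod, Nat.mod_mod]
        rfl
      rw [Finset.sum_comm]
      simp only [ih, omega_pow_mod, Finset.sum_range_succ, Finset.sum_range_zero, zero_add,
        Fin.sum_univ_two]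
      have h0 := sqrt_two_mul_hMat (s i) 0
      have h1 := sqrt_two_mul_hMat (s i) 1
      rw [show Fin.ofNat 2 0 = 0 from rfl, show Fin.ofNat 2 1 = 1 from rfl]
      simp only [Fin.val_zero, Fin.val_one] at h0 h1
      rw [show 0 % 2 = 0 from rfl, show 1 % 2 = 1 from rfl, pow_add, pow_add, ← h0, ← h1]
      ring
    | T i =>
      simp only [Gate.isH, Gate.mat, sum_mul_onQubit, Bool.false_eq_true, if_false, add_zero]
      refine (ih s ((ph + (s i : ℕ)) % 8)).trans ?_
      rw [omega_pow_mod, Finset.sum_eq_single (s i)]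
      · rw [Function.update_eq_self, pow_add]
        have : omega ^ ((s i : ℕ)) = tMat (s i) (s i) := by
          generalize s i = u
          fin_cases u <;> simp [tMat]
        rw [this]
        ring
      · intro v _ hv
        have : tMat v (s i) = 0 := by
          generalize s i = u at hv ⊢
          revert hv
          fin_cases u <;> fin_cases v <;> simp [tMat]
        rw [this, mul_zero]
      · simp
    | CZ i j hij =>
      simp only [Gate.isH, Gate.mat, Bool.false_eq_true, if_false, add_zero, czMat,
        Matrix.diagonal_apply, mul_ite, mul_zero, Finset.sum_ite_eq', Finset.mem_univ, if_true]
      refine (ih s ((ph + 4 * ((s i : ℕ) * (s j : ℕ))) % 8)).trans ?_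
      rw [omega_pow_mod]
      have : omega ^ (4 * ((s i : ℕ) * (s j : ℕ))) = if s i = 1 ∧ s j = 1 then -1 else 1 := by
        rw [pow_mul, omega_pow_four]
        generalize s i = u
        generalize s j = v
        fin_cases u <;> fin_cases v <;> simp
      rw [pow_add, this]
      split_ifs <;> ring

/-- Symmetry, not unitarity, is what allows the second half to be run backwards: no phases have to
be conjugated. -/
theorem Gate.transpose_mat {N : ℕ} (g : Gate N) : g.mat.transpose = g.mat := by
  have hq (i : Fin N) (M : Matrix (Fin 2) (Fin 2) ℂ) (hM : M.transpose = M) :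
      (onQubit i M).transpose = onQubit i M := by
    ext x y
    simp only [Matrix.transpose_apply, onQubit, eq_comm]
    rw [← Matrix.transpose_apply M, hM]
  cases g with
  | H i => exact hq i _ (by ext u v; fin_cases u <;> fin_cases v <;> simp [hMat])
  | T i => exact hq i _ (by ext u v; fin_cases u <;> fin_cases v <;> simp [tMat])
  | CZ i j _ => exact Matrix.diagonal_transpose _

theorem Circuit.mat_append {N : ℕ} (U V : Circuit N) :
    Circuit.mat (U ++ V) = V.mat * U.mat := by
  induction U with
  | nil => exact (Matrix.mul_one _).symm
  | cons g U ih =>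
    rw [List.cons_append, Circuit.mat, ih, Circuit.mat, Matrix.mul_assoc]

theorem Circuit.mat_reverse {N : ℕ} (U : Circuit N) :
    Circuit.mat (List.reverse U) = U.mat.transpose := by
  induction U with
  | nil => exact Matrix.transpose_one.symm
  | cons g U ih =>
    rw [List.reverse_cons, Circuit.mat_append, ih, Circuit.mat, Circuit.mat,
      Circuit.mat, Matrix.transpose_mul, g.transpose_mat, Matrix.one_mul]

/-- The outcome of a path: the final bit string and the final phase in one number. -/
def outcome {N : ℕ} (U : Circuit N) (x : ℕ × Bits N × ℕ) : ℕ :=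
  8 * enc (U.run x).2.1 + (U.run x).2.2

/-- The number of paths below `k` from `b` with outcome `q`. -/
def pathCount {N : ℕ} (U : Circuit N) (b : Bits N) (k q : ℕ) : ℕ :=
  ∑ x ∈ Finset.range k, if outcome U (x, b, 0) = q then 1 else 0

/-- The number of pairs of paths that meet, the second one from `a`, with total phase `q`. -/
def pairCount {N : ℕ} (V : Circuit N) (a : Bits N) (f : ℕ → ℕ) (k q : ℕ) : ℕ :=
  ∑ w ∈ Finset.range k, if (V.run (w / 8, a, w % 8)).2.2 = q then
    f (8 * enc (V.run (w / 8, a, w % 8)).2.1 + w % 8) else 0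

/-- Insert the intermediate string `s` into `⟨a|V U|b⟩` and expand both factors by `sum_paths`. The
backward path is started with the phase `w % 8` of the forward paths it is to be joined to, so its
final phase is already the total phase of the pair. -/
theorem sum_pairCount {N : ℕ} (U V : Circuit N) (a b : Bits N) :
    ∑ q ∈ Finset.range 8, (pairCount (List.reverse V) a (pathCount U b (2 ^ U.numH))
        (8 * 2 ^ V.numH) q : ℂ) * omega ^ q =
      ((Real.sqrt 2 : ℝ) : ℂ) ^ Circuit.numH (U ++ V) * Circuit.amplitude (U ++ V) a b := by
  set V' : Circuit N := List.reverse V with hV'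
  have hV'H : V'.numH = V.numH := Circuit.numH_reverse V
  have hmeet (x : ℕ) : ∑ w ∈ Finset.range (8 * 2 ^ V.numH),
      (if outcome U (x, b, 0) = 8 * enc (V'.run (w / 8, a, w % 8)).2.1 + w % 8 then
        omega ^ (V'.run (w / 8, a, w % 8)).2.2 else 0) =
      omega ^ (U.run (x, b, 0)).2.2 * ((Real.sqrt 2 : ℝ) : ℂ) ^ V.numH *
        V.mat a (U.run (x, b, 0)).2.1 := by
    have hx : (U.run (x, b, 0)).2.2 < 8 := U.run_phase_lt (by norm_num)
    rw [sum_range_mul_mod_div (c := 8) (by norm_num) _ (fun r z =>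
      if outcome U (x, b, 0) = 8 * enc (V'.run (z, a, r)).2.1 + r then
        omega ^ (V'.run (z, a, r)).2.2 else 0), ← Matrix.transpose_apply V.mat,
      ← Circuit.mat_reverse, ← hV', ← hV'H, ← sum_paths]
    refine Finset.sum_congr rfl fun z _ => ?_
    -- A phase is below 8, so equality of `8 * enc + phase` forces equality of both parts; only the
    -- start phase equal to that of the forward path `x` survives.
    rw [Finset.sum_eq_single (U.run (x, b, 0)).2.2]
    · simp only [outcome, add_left_inj, mul_eq_mul_left_iff, enc_injective.eq_iff]
      simp [eq_comm]
    · intro r hr hne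
      have hr := Finset.mem_range.1 hr
      refine if_neg fun h => hne ?_
      rw [outcome] at h
      omega
    · intro h
      exact absurd (Finset.mem_range.2 hx) h
  calc _ = ∑ w ∈ Finset.range (8 * 2 ^ V.numH), ∑ x ∈ Finset.range (2 ^ U.numH),
      (if outcome U (x, b, 0) = 8 * enc (V'.run (w / 8, a, w % 8)).2.1 + w % 8 then
        omega ^ (V'.run (w / 8, a, w % 8)).2.2 else 0) := by
        simp only [pairCount, Nat.cast_sum, Finset.sum_mul]
        rw [Finset.sum_comm]
        refine Finset.sum_congr rfl fun w _ => ?_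
        rw [Finset.sum_eq_single (V'.run (w / 8, a, w % 8)).2.2]
        · simp only [if_true, pathCount, Nat.cast_sum, Finset.sum_mul]
          refine Finset.sum_congr rfl fun x _ => ?_
          split_ifs <;> simp
        · intro q _ hq
          simp [hq.symm]
        · intro h
          exact absurd (Finset.mem_range.2 (V'.run_phase_lt (Nat.mod_lt _ (by norm_num)))) h
    _ = ∑ x ∈ Finset.range (2 ^ U.numH), ∑ s, if (U.run (x, b, 0)).2.1 = s then
        omega ^ (U.run (x, b, 0)).2.2 * ((Real.sqrt 2 : ℝ) : ℂ) ^ V.numH * V.mat a s else 0 := by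
        rw [Finset.sum_comm]
        refine Finset.sum_congr rfl fun x _ => ?_
        rw [hmeet]
        simp
    _ = ∑ s, (omega ^ 0 * ((Real.sqrt 2 : ℝ) : ℂ) ^ U.numH * U.mat s b) *
        (((Real.sqrt 2 : ℝ) : ℂ) ^ V.numH * V.mat a s) := by
        rw [Finset.sum_comm]
        refine Finset.sum_congr rfl fun s _ => ?_
        rw [← sum_paths, Finset.sum_mul]
        refine Finset.sum_congr rfl fun x _ => ?_
        split_ifs <;> ring
    _ = _ := by
        rw [Circuit.amplitude, Circuit.mat_append, Matrix.mul_apply, Circuit.numH_append,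
          Finset.mul_sum]
        refine Finset.sum_congr rfl fun s _ => ?_
        ring

/-- The relation `omega ^ (j + 4) = -omega ^ j` pairs the eight phases into four signed
coefficients. -/
theorem amplitude_append {N : ℕ} (U V : Circuit N) (a b : Bits N) (C : ℕ → ℕ)
    (hC : ∀ q, C q = pairCount (List.reverse V) a (pathCount U b (2 ^ U.numH))
      (8 * 2 ^ V.numH) q) :
    Circuit.amplitude (U ++ V) a b = (∑ j : Fin 4, (((C j : ℤ) - C (j + 4) : ℤ) : ℂ) *
      omega ^ (j : ℕ)) / ((Real.sqrt 2 : ℝ) : ℂ) ^ Circuit.numH (U ++ V) := by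
  have h : ((Real.sqrt 2 : ℝ) : ℂ) ≠ 0 := by simp
  rw [eq_div_iff (pow_ne_zero _ h), mul_comm, ← sum_pairCount]
  simp only [← hC, Finset.sum_range_succ, Finset.sum_range_zero, Fin.sum_univ_four]
  have h5 : omega ^ 5 = -omega ^ 1 := by rw [pow_add omega 4 1, omega_pow_four]; ring
  have h6 : omega ^ 6 = -omega ^ 2 := by rw [pow_add omega 4 2, omega_pow_four]; ring
  have h7 : omega ^ 7 = -omega ^ 3 := by rw [pow_add omega 4 3, omega_pow_four]; ring
  rw [h5, h6, h7, omega_pow_four]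
  simp
  ring

end QCirc

namespace RAM

/-! ### The program -/

/-- The programs of a list one after the other. -/
def block : List Prog → Prog
  | [] => .skip
  | p :: ps => .seq p (block ps)

/-- The registers between two stages of the program: registers `0` to `3` and `19` are scratch. -/
abbrev regs (S ph z addr cnt d L x A B Y X p m T G : ℤ) : List ℤ :=
  [0, 0, 0, 0, S, ph, z, addr, cnt, d, L, x, A, B, Y, X, p, m, T, 0, G]

/-- Follow a path through one gate. The gate is at address `r 7`, the table of powers of two at
`r 10`, the bit string in `r 4`, the phase in `r 5` and the branches to come in `r 6`. -/
def gateStep : Prog := block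
  [.load 0 7, .const 3 1, .arith .add 7 7 3,
   .load 1 7, .arith .add 1 1 10, .load 1 1, .arith .add 7 7 3,
   .load 2 7, .arith .add 2 2 10, .load 2 2, .arith .add 7 7 9,
   .arith .sub 8 8 3,
   .const 3 2, .arith .div 19 4 1, .arith .mod 19 19 3,
   .cond 0
    (block [.const 3 1, .arith .sub 0 0 3,
      .cond 0
        (block [.const 3 2, .arith .div 2 4 2, .arith .mod 2 2 3, .arith .mul 2 19 2,
          .const 3 4, .arith .mul 2 3 2, .arith .add 5 5 2])
        (.arith .add 5 5 19)])
    (block [.arith .mod 2 6 3, .arith .div 6 6 3,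
      .arith .sub 0 2 19, .arith .mul 0 0 1, .arith .add 4 4 0,
      .arith .mul 2 19 2, .const 3 4, .arith .mul 2 3 2, .arith .add 5 5 2]),
   .const 3 8, .arith .mod 5 5 3,
   .const 0 0, .const 1 0, .const 2 0, .const 3 0, .const 19 0]

/-- The memory holds the gate `g` at address `z`. -/
def GateAt {N : ℕ} (M : ℕ → ℤ) (z : ℤ) (g : QCirc.Gate N) : Prop :=
  [M z.toNat, M (z + 1).toNat, M (z + 1 + 1).toNat] = g.encode

/-- The memory holds the first `N` powers of two from address `L` on. -/
def PowersAt (N : ℕ) (M : ℕ → ℤ) (L : ℤ) : Prop := ∀ i : Fin N, M ((i : ℕ) + L).toNat = 2 ^ (i : ℕ)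

theorem enc_div_mod_cast {N : ℕ} (s : QCirc.Bits N) (i : Fin N) :
    (QCirc.enc s : ℤ) / 2 ^ (i : ℕ) % 2 = (s i : ℕ) := by
  exact_mod_cast QCirc.enc_div_mod s i

/-- Symbolic execution for each kind of gate. The bit of a qubit is read off as `S / 2 ^ i % 2`,
with the power taken from the table at `L`. The scratch registers are cleared at the end so that the
state has the shape `regs` again. The address moves by `d + 2`, so that the same code reads the
gates forwards (`d = 1`) and backwards (`d = -5`). -/
theorem eval_gateStep {N : ℕ} {M : ℕ → ℤ} {addr L : ℤ} {g : QCirc.Gate N}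
    (hg : GateAt M addr g) (hL : PowersAt N M L) (y : ℕ × QCirc.Bits N × ℕ)
    (cnt d x A B Y X p m T G : ℤ) :
    gateStep.eval (regs (QCirc.enc y.2.1) y.2.2 y.1 addr cnt d L x A B Y X p m T G, M) =
      (regs (QCirc.enc (g.step y).2.1) (g.step y).2.2 (g.step y).1 (addr + 1 + 1 + d) (cnt - 1) d L
        x A B Y X p m T G, M) := by
  cases g with
  | H i =>
    simp only [GateAt, QCirc.Gate.encode, List.cons.injEq, and_true] at hg
    obtain ⟨h0, h1, h2⟩ := hg
    simp [gateStep, block, Prog.eval, Op.eval, h0, h1, h2, hL i, QCirc.Gate.step,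
      enc_div_mod_cast, QCirc.enc_update]
  | T i =>
    simp only [GateAt, QCirc.Gate.encode, List.cons.injEq, and_true] at hg
    obtain ⟨h0, h1, h2⟩ := hg
    simp [gateStep, block, Prog.eval, Op.eval, h0, h1, h2, hL i, QCirc.Gate.step,
      enc_div_mod_cast]
  | CZ i j hij =>
    simp only [GateAt, QCirc.Gate.encode, List.cons.injEq, and_true] at hg
    obtain ⟨h0, h1, h2⟩ := hg
    simp [gateStep, block, Prog.eval, Op.eval, h0, h1, h2, hL i, hL j, QCirc.Gate.step,
      enc_div_mod_cast]

theorem straight_gateStep : gateStep.Straight 21 := by decide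

end RAM

/-! ### The loops over paths: forward counting and backward matching. -/

namespace RAM

theorem len_le_of_nat_lt {n w : ℕ} (h : n < 2 ^ w) : len (n : ℤ) ≤ w + 1 :=
  len_le_iff.2 (by rw [Nat.abs_cast]; exact_mod_cast h)

theorem Bounded.working {w : ℕ} {M : ℕ → ℤ} {S ph z addr cnt d L x A B Y X p m T G : ℤ}
    (h : Bounded (w + 1) (regs 0 0 0 0 0 d L x A B Y X p m T G, M))
    (hS : len S ≤ w + 1) (hph : len ph ≤ w + 1) (hz : len z ≤ w + 1) (haddr : len addr ≤ w + 1)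
    (hcnt : len cnt ≤ w + 1) :
    Bounded (w + 1) (regs S ph z addr cnt d L x A B Y X p m T G, M) :=
  ((((h.set hS 4).set hph 5).set hz 6).set haddr 7).set hcnt 8

/-- A time bound for following a path through `n` gates. -/
def gateLoopTime (n W : ℕ) : ℕ := n * (W + gateStep.costFactor * W ^ 2) + W

/-- One bound `2 ^ w` on all data holds in every round, since the string stays below `2 ^ N`, the
phase below 8 and the branch number never increases. The growth allowed by `Prog.bounded_eval`
therefore does not accumulate over the rounds. -/
theorem runs_gateLoop {N w : ℕ} {M : ℕ → ℤ} {d L x A B Y X p m T G : ℤ} (hL : PowersAt N M L)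
    (hB : Bounded (w + 1) (regs 0 0 0 0 0 d L x A B Y X p m T G, M)) (hN : N ≤ w) (hw : 3 ≤ w)
    (U : QCirc.Circuit N) (y : ℕ × QCirc.Bits N × ℕ) (addr : ℤ) (hy : y.1 < 2 ^ w)
    (hph : y.2.2 < 8) (hlen : |addr| + |d + 2| * U.length < 2 ^ w) (hlen' : U.length < 2 ^ w)
    (hU : ∀ (k : ℕ) (hk : k < U.length), GateAt M (addr + (d + 2) * k) U[k]) :
    Runs (.loop 8 gateStep)
      (regs (QCirc.enc y.2.1) y.2.2 y.1 addr U.length d L x A B Y X p m T G, M)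
      (regs (QCirc.enc (U.run y).2.1) (U.run y).2.2 (U.run y).1 (addr + (d + 2) * U.length) 0 d L
        x A B Y X p m T G, M) (gateLoopTime U.length (w + 1)) := by
  induction U generalizing y addr with
  | nil =>
    simp only [List.length_nil, Nat.cast_zero, mul_zero, add_zero, gateLoopTime, zero_mul,
      zero_add, QCirc.Circuit.run, List.foldl_nil]
    exact .loop_nonpos (by simp) (by simp [len])
  | cons g U ih =>
    have hcnt : len ((g :: U).length : ℤ) ≤ w + 1 := len_le_of_nat_lt hlen'
    have haddr : |addr| < 2 ^ w := by
      have : 0 ≤ |d + 2| * ((g :: U).length : ℤ) := by positivity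
      linarith
    have hb := hB.working (S := QCirc.enc y.2.1) (ph := y.2.2) (z := y.1) (addr := addr)
      (cnt := (g :: U).length)
      (len_le_of_nat_lt ((QCirc.enc_lt _).trans_le (Nat.pow_le_pow_right two_pos hN)))
      (len_le_of_nat_lt (hph.trans_le (Nat.pow_le_pow_right two_pos hw)))
      (len_le_of_nat_lt hy) (len_le_iff.2 haddr) hcnt
    have hg : GateAt M addr g := by
      have := hU 0 (Nat.succ_pos _)
      rwa [Nat.cast_zero, mul_zero, add_zero] at this
    have h1 := Runs.straight straight_gateStep rfl (Nat.le_add_left 1 w) hb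
      (eval_gateStep hg hL y _ d x A B Y X p m T G)
    have h2 := ih (g.step y) (addr + 1 + 1 + d) ((g.step_path_le y).trans_lt hy)
      (g.step_phase_lt y) (by
        have h := abs_add_le addr (d + 2)
        rw [List.length_cons] at hlen
        push_cast at hlen
        rw [show addr + 1 + 1 + d = addr + (d + 2) by ring]
        linarith) (by rw [List.length_cons] at hlen'; omega) (fun k hk => by
        have := hU (k + 1) (by simpa using hk)
        rw [List.getElem_cons_succ] at this
        convert this using 1
        push_cast
        ring)
    have e1 : (((g :: U).length : ℕ) : ℤ) - 1 = U.length := by simp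
    have e2 : addr + (d + 2) * ((g :: U).length : ℕ) =
        addr + 1 + 1 + d + (d + 2) * (U.length : ℕ) := by
      rw [List.length_cons]; push_cast; ring
    rw [e1] at h1
    rw [QCirc.Circuit.run_cons, e2]
    refine (Runs.loop_pos (W := w + 1) ?_ ?_ h1 h2).mono (le_of_eq ?_)
    · simp only [List.length_cons, List.getD_cons_succ, List.getD_cons_zero]
      positivity
    · exact hcnt
    · rw [gateLoopTime, gateLoopTime, List.length_cons]
      ring

/-- The memory with contents `base` below `T`, followed by eight counters `g` and a table `f`. -/
def lay (T : ℕ) (base : ℕ → ℤ) (g f : ℕ → ℕ) : ℕ → ℤ := fun n =>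
  if n < T then base n else if n < T + 8 then g (n - T) else f (n - (T + 8))

theorem lay_table (T : ℕ) (base : ℕ → ℤ) (g f : ℕ → ℕ) (q : ℕ) :
    lay T base g f (T + 8 + q) = f q := by
  rw [lay, if_neg (by omega), if_neg (by omega), Nat.add_sub_cancel_left]

theorem lay_counter (T : ℕ) (base : ℕ → ℤ) (g f : ℕ → ℕ) {q : ℕ} (hq : q < 8) :
    lay T base g f (T + q) = g q := by
  rw [lay, if_neg (by omega), if_pos (by omega), Nat.add_sub_cancel_left]

/-- Writing to the table keeps the layout, so the machine's memory can be followed as a change of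
the function `f` alone. -/
theorem update_lay_table (T : ℕ) (base : ℕ → ℤ) (g f : ℕ → ℕ) (q v : ℕ) :
    Function.update (lay T base g f) (T + 8 + q) v = lay T base g (Function.update f q v) := by
  funext n
  simp only [lay, Function.update_apply]
  split_ifs <;> first | rfl | omega

theorem update_lay_counter (T : ℕ) (base : ℕ → ℤ) (g f : ℕ → ℕ) {q : ℕ} (hq : q < 8) (v : ℕ) :
    Function.update (lay T base g f) (T + q) v = lay T base (Function.update g q v) f := by
  funext n
  simp only [lay, Function.update_apply]
  split_ifs <;> first | rfl | omega

theorem Bounded.lay {w T : ℕ} {l : List ℤ} {base : ℕ → ℤ} {g f : ℕ → ℕ}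
    (h : Bounded (w + 1) (l, base)) (hg : ∀ q < 8, g q < 2 ^ w) (hf : ∀ q, f q < 2 ^ w) :
    Bounded (w + 1) (l, lay T base g f) := by
  refine ⟨h.1, fun n => ?_⟩
  simp only [RAM.lay]
  split_ifs with h1 h2
  · exact h.2 n
  · exact len_le_of_nat_lt (hg _ (by omega))
  · exact len_le_of_nat_lt (hf _)

/-- The start of a path from `B` through the first part of the circuit. -/
def forwardStart : Prog := block
  [.move 4 13, .const 3 1, .arith .sub 11 11 3, .move 6 11, .move 7 20, .move 8 16, .const 9 1,
   .const 3 0]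

/-- Count the outcome of a path in the table. -/
def forwardEnd : Prog := block
  [.const 3 8, .arith .mul 0 4 3, .arith .add 0 0 5, .arith .add 0 0 18, .arith .add 0 0 3,
   .load 1 0, .const 3 1, .arith .add 1 1 3, .store 0 1,
   .const 0 0, .const 1 0, .const 3 0, .const 4 0, .const 5 0, .const 6 0, .const 7 0,
   .const 9 0]

/-- One path through the first part of the circuit. -/
def forwardBody : Prog := .seq forwardStart (.seq (.loop 8 gateStep) forwardEnd)

theorem eval_forwardStart (M : ℕ → ℤ) (L x A B Y X p m T G : ℤ) :
    forwardStart.eval (regs 0 0 0 0 0 0 L (x + 1) A B Y X p m T G, M) =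
      (regs B 0 x G p 1 L x A B Y X p m T G, M) := by
  simp [forwardStart, block, Prog.eval, Op.eval]

theorem eval_forwardEnd (base : ℕ → ℤ) (g f : ℕ → ℕ) (S ph T : ℕ)
    (z addr d L x A B Y X p m G : ℤ) :
    forwardEnd.eval (regs S ph z addr 0 d L x A B Y X p m T G, lay T base g f) =
      (regs 0 0 0 0 0 0 L x A B Y X p m T G,
        lay T base g (Function.update f (8 * S + ph) (f (8 * S + ph) + 1))) := by
  have e : ((S : ℤ) * 8 + ph + T + 8).toNat = T + 8 + (8 * S + ph) := by omega
  have e2 : (f (8 * S + ph) : ℤ) + 1 = ((f (8 * S + ph) + 1 : ℕ) : ℤ) := by push_cast; rfl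
  simp only [forwardEnd, block, Prog.eval, Op.eval, List.set_cons_succ, List.set_cons_zero,
    List.getD_cons_succ, List.getD_cons_zero, e, lay_table, e2, update_lay_table]

/-- The start of a path from `A` through the reversed second part of the circuit. -/
def backwardStart : Prog := block
  [.const 3 1, .arith .sub 11 11 3, .const 3 8, .arith .mod 14 11 3, .arith .div 6 11 3,
   .move 5 14, .move 4 12, .const 3 3, .arith .sub 7 10 3, .move 8 16, .const 9 (-5), .const 3 0]

/-- Add the number of paths that meet the current one to the counter of its phase. -/
def backwardEnd : Prog := block
  [.const 3 8, .arith .mul 0 4 3, .arith .add 0 0 14, .arith .add 0 0 18, .arith .add 0 0 3,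
   .load 1 0, .arith .add 0 18 5, .load 2 0, .arith .add 2 2 1, .store 0 2,
   .const 0 0, .const 1 0, .const 2 0, .const 3 0, .const 4 0, .const 5 0, .const 6 0, .const 7 0,
   .const 9 0, .const 14 0]

/-- One path through the reversed second part of the circuit. -/
def backwardBody : Prog := .seq backwardStart (.seq (.loop 8 gateStep) backwardEnd)

theorem eval_backwardStart (M : ℕ → ℤ) (L x A B X p m T G : ℤ) :
    backwardStart.eval (regs 0 0 0 0 0 0 L (x + 1) A B 0 X p m T G, M) =
      (regs A (x % 8) (x / 8) (L - 3) p (-5) L x A B (x % 8) X p m T G, M) := by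
  simp [backwardStart, block, Prog.eval, Op.eval]

theorem eval_backwardEnd (base : ℕ → ℤ) (g f : ℕ → ℕ) (S ph T r : ℕ) (hph : ph < 8)
    (z addr d L x A B X p m G : ℤ) :
    backwardEnd.eval (regs S ph z addr 0 d L x A B r X p m T G, lay T base g f) =
      (regs 0 0 0 0 0 0 L x A B 0 X p m T G,
        lay T base (Function.update g ph (g ph + f (8 * S + r))) f) := by
  have e : ((S : ℤ) * 8 + r + T + 8).toNat = T + 8 + (8 * S + r) := by omega
  have e' : ((T : ℤ) + ph).toNat = T + ph := by omega
  have e2 : (g ph : ℤ) + f (8 * S + r) = ((g ph + f (8 * S + r) : ℕ) : ℤ) := by push_cast; rfl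
  simp only [backwardEnd, block, Prog.eval, Op.eval, List.set_cons_succ, List.set_cons_zero,
    List.getD_cons_succ, List.getD_cons_zero, e, e', lay_table, lay_counter _ _ _ _ hph, e2,
    update_lay_counter _ _ _ _ hph]

/-- A time bound for following one path, with the programs `P` before and `Q` after it. -/
def pathTime (P Q : Prog) (n W : ℕ) : ℕ :=
  P.costFactor * W ^ 2 + (gateLoopTime n W + Q.costFactor * W ^ 2)

/-- The common part of both directions. The address of a table cell may exceed `2 ^ w`, but it
occurs only inside the loop-free `P` and `Q`, where the growth factors account for it. -/
theorem runs_path {P Q : Prog} (hP : P.Straight 21) (hQ : Q.Straight 21) {N w : ℕ}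
    {M M' : ℕ → ℤ} {l l' : List ℤ} {d L x A B Y X p m T G : ℤ} (hL : PowersAt N M L)
    (hl : l.length = 21) (hlM : Bounded (w + 1) (l, M))
    (hB : Bounded (w + 1) (regs 0 0 0 0 0 d L x A B Y X p m T G, M)) (hN : N ≤ w) (hw : 3 ≤ w)
    (U : QCirc.Circuit N) (y : ℕ × QCirc.Bits N × ℕ) (addr : ℤ) (hy : y.1 < 2 ^ w)
    (hph : y.2.2 < 8) (hlen : |addr| + |d + 2| * U.length < 2 ^ w) (hlen' : U.length < 2 ^ w)
    (hU : ∀ (k : ℕ) (hk : k < U.length), GateAt M (addr + (d + 2) * k) U[k])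
    (hstart : P.eval (l, M) =
      (regs (QCirc.enc y.2.1) y.2.2 y.1 addr U.length d L x A B Y X p m T G, M))
    (hend : Q.eval (regs (QCirc.enc (U.run y).2.1) (U.run y).2.2 (U.run y).1
      (addr + (d + 2) * U.length) 0 d L x A B Y X p m T G, M) = (l', M')) :
    Runs (.seq P (.seq (.loop 8 gateStep) Q)) (l, M) (l', M') (pathTime P Q U.length (w + 1)) := by
  have h1 := Runs.straight hP hl (Nat.le_add_left 1 w) hlM hstart
  have h2 := runs_gateLoop hL hB hN hw U y addr hy hph hlen hlen' hU
  refine h1.seq (h2.seq (Runs.straight hQ rfl (Nat.le_add_left 1 w) (hB.working ?_ ?_ ?_ ?_ ?_)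
    hend))
  · exact len_le_of_nat_lt ((QCirc.enc_lt _).trans_le (Nat.pow_le_pow_right two_pos hN))
  · exact len_le_of_nat_lt ((U.run_phase_lt hph).trans_le (Nat.pow_le_pow_right two_pos hw))
  · exact len_le_of_nat_lt ((U.run_path_le y).trans_lt hy)
  · refine len_le_iff.2 ((abs_add_le _ _).trans_lt ?_)
    rwa [abs_mul, Nat.abs_cast]
  · exact (show len 0 = 1 by decide).trans_le (Nat.le_add_left 1 w)

/-- A time bound for a loop over `k` paths. -/
def pathLoopTime (P Q : Prog) (n W k : ℕ) : ℕ := k * (W + pathTime P Q n W) + W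

theorem pathLoopTime_succ (P Q : Prog) (n W k : ℕ) :
    W + pathTime P Q n W + pathLoopTime P Q n W k = pathLoopTime P Q n W (k + 1) := by
  rw [pathLoopTime, pathLoopTime]
  ring

/-- The counter is decremented before use, so the round with counter `k + 1` follows path `k`. The
count of that path is the last term of the sum in `pathCount`. Each round raises a cell by at most
1, hence the condition `f q + k < 2 ^ w`. -/
theorem runs_forwardLoop {N w T : ℕ} {base : ℕ → ℤ} {L A Y X m : ℤ} {g : ℕ → ℕ} {G : ℕ}
    (b : QCirc.Bits N) (U : QCirc.Circuit N) (hL : ∀ f, PowersAt N (lay T base g f) L)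
    (hN : N ≤ w) (hw : 3 ≤ w)
    (hB : ∀ x, len x ≤ w + 1 → ∀ d, len d ≤ w + 1 →
      Bounded (w + 1) (regs 0 0 0 0 0 d L x A (QCirc.enc b) Y X U.length m T G, base))
    (hlen : G + 3 * U.length < 2 ^ w)
    (hU : ∀ f, ∀ (k : ℕ) (hk : k < U.length), GateAt (lay T base g f) (G + 3 * k) U[k])
    (hg : ∀ q < 8, g q < 2 ^ w) (k : ℕ) (f : ℕ → ℕ) (hf : ∀ q, f q + k < 2 ^ w) :
    Runs (.loop 11 forwardBody)
      (regs 0 0 0 0 0 0 L k A (QCirc.enc b) Y X U.length m T G, lay T base g f)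
      (regs 0 0 0 0 0 0 L 0 A (QCirc.enc b) Y X U.length m T G,
        lay T base g fun q => f q + QCirc.pathCount U b k q)
      (pathLoopTime forwardStart forwardEnd U.length (w + 1) k) := by
  have len1 : len 1 ≤ w + 1 := by rw [show len 1 = 2 by decide]; omega
  have len0 : len 0 ≤ w + 1 := by rw [show len 0 = 1 by decide]; omega
  induction k generalizing f with
  | zero =>
    simp only [QCirc.pathCount, Finset.range_zero, Finset.sum_empty, add_zero, pathLoopTime,
      zero_mul, zero_add]
    exact .loop_nonpos (by simp) (by simpa using len0)
  | succ k ih =>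
    have hk : k + 1 < 2 ^ w := by have := hf 0; omega
    have hf1 (q : ℕ) : f q < 2 ^ w := by have := hf q; omega
    have lenk1 : len ((k + 1 : ℕ) : ℤ) ≤ w + 1 := len_le_of_nat_lt hk
    have h1 := runs_path (P := forwardStart) (Q := forwardEnd) (x := k)
      (l := regs 0 0 0 0 0 0 L (k + 1 : ℕ) A (QCirc.enc b) Y X U.length m T G)
      (by decide) (by decide)
      (hL f) rfl ((hB _ lenk1 0 len0).lay (T := T) hg hf1)
      ((hB _ (len_le_of_nat_lt (by omega)) 1 len1).lay (T := T) hg hf1) hN hw U (k, b, 0) G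
      (show k < _ by omega) (show 0 < 8 by norm_num)
      (by rw [Nat.abs_cast]; norm_num; exact_mod_cast hlen) (by omega)
      (fun j hj => by norm_num; exact hU f j hj)
      (by rw [Nat.cast_succ]; exact eval_forwardStart _ L k A _ Y X _ m T G)
      (eval_forwardEnd ..)
    have h2 := ih (Function.update f (QCirc.outcome U (k, b, 0))
      (f (QCirc.outcome U (k, b, 0)) + 1)) (fun q => by
        have h3 := hf q
        have h4 := hf (QCirc.outcome U (k, b, 0))
        rw [Function.update_apply]
        split_ifs <;> omega)
    have h3 := Runs.loop_pos (i := 11) (W := w + 1) (by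
      simp only [List.getD_cons_succ, List.getD_cons_zero]
      positivity) (by exact lenk1) h1 h2
    rw [pathLoopTime_succ] at h3
    have e : (fun q => f q + QCirc.pathCount U b (k + 1) q) = fun q =>
        Function.update f (QCirc.outcome U (k, b, 0)) (f (QCirc.outcome U (k, b, 0)) + 1) q +
          QCirc.pathCount U b k q := by
      funext q
      simp only [QCirc.pathCount, Finset.sum_range_succ, Function.update_apply, eq_comm (a := q)]
      split_ifs with h
      · subst h; ring
      · ring
    rw [e]
    exact h3

/-- The gates are read downwards from the last record, which starts at `L - 3`. Each round adds one
table entry, at most `K`, to one counter, hence the condition `g q + k * K < 2 ^ w`. -/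
theorem runs_backwardLoop {N w T : ℕ} {base : ℕ → ℤ} {L B X m G : ℤ} {f : ℕ → ℕ} {K : ℕ}
    (a : QCirc.Bits N) (U : QCirc.Circuit N) (hL : ∀ g, PowersAt N (lay T base g f) L)
    (hN : N ≤ w) (hw : 3 ≤ w)
    (hB : ∀ x, len x ≤ w + 1 → ∀ d, len d ≤ w + 1 → ∀ r, len r ≤ w + 1 →
      Bounded (w + 1) (regs 0 0 0 0 0 d L x (QCirc.enc a) B r X U.length m T G, base))
    (hlen : |L - 3| + 3 * U.length < 2 ^ w) (hlen' : U.length < 2 ^ w)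
    (hU : ∀ g, ∀ (k : ℕ) (hk : k < U.length), GateAt (lay T base g f) (L - 3 - 3 * k) U[k])
    (hf : ∀ q, f q ≤ K) (hK : K < 2 ^ w) (k : ℕ) (hk : k < 2 ^ w) (g : ℕ → ℕ)
    (hg : ∀ q < 8, g q + k * K < 2 ^ w) :
    ∃ g', Runs (.loop 11 backwardBody)
      (regs 0 0 0 0 0 0 L k (QCirc.enc a) B 0 X U.length m T G, lay T base g f)
      (regs 0 0 0 0 0 0 L 0 (QCirc.enc a) B 0 X U.length m T G, lay T base g' f)
      (pathLoopTime backwardStart backwardEnd U.length (w + 1) k) ∧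
      (∀ q < 8, g' q < 2 ^ w) ∧ ∀ q, g' q = g q + QCirc.pairCount U a f k q := by
  have len5 : len (-5) ≤ w + 1 := by rw [show len (-5) = 4 by decide]; omega
  have len0 : len 0 ≤ w + 1 := by rw [show len 0 = 1 by decide]; omega
  have hf1 (q : ℕ) : f q < 2 ^ w := (hf q).trans_lt hK
  induction k generalizing g with
  | zero =>
    refine ⟨g, ?_, by simpa using hg, by simp [QCirc.pairCount]⟩
    simp only [pathLoopTime, zero_mul, zero_add]
    exact .loop_nonpos (by simp) (by simpa using len0)
  | succ k ih =>
    have hg1 (q : ℕ) (hq : q < 8) : g q < 2 ^ w := by have := hg q hq; omega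
    have lenk1 : len ((k + 1 : ℕ) : ℤ) ≤ w + 1 := len_le_of_nat_lt hk
    have hr : k % 8 < 8 := Nat.mod_lt _ (by norm_num)
    have hph := U.run_phase_lt (x := (k / 8, a, k % 8)) hr
    have h1 := runs_path (P := backwardStart) (Q := backwardEnd) (x := k) (Y := (k % 8 : ℕ))
      (l := regs 0 0 0 0 0 0 L (k + 1 : ℕ) (QCirc.enc a) B 0 X U.length m T G)
      (by decide) (by decide)
      (hL g) rfl ((hB _ lenk1 0 len0 0 len0).lay (T := T) hg1 hf1)
      ((hB _ (len_le_of_nat_lt (by omega)) (-5) len5 (k % 8 : ℕ)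
        (len_le_of_nat_lt (hr.trans_le (Nat.pow_le_pow_right two_pos hw)))).lay (T := T) hg1 hf1)
      hN hw U (k / 8, a, k % 8) (L - 3)
      (show k / 8 < _ by omega) hr (by norm_num; exact hlen) hlen'
      (fun j hj => by
        rw [show L - 3 + (-5 + 2) * (j : ℤ) = L - 3 - 3 * j by ring]
        exact hU g j hj)
      (by rw [Nat.cast_succ]; exact eval_backwardStart _ L k _ B X _ m T G)
      (eval_backwardEnd _ _ _ _ _ _ _ hph ..)
    obtain ⟨g', h2, h2', h2''⟩ := ih (by omega) (Function.update g (U.run (k / 8, a, k % 8)).2.2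
      (g (U.run (k / 8, a, k % 8)).2.2 +
        f (8 * QCirc.enc (U.run (k / 8, a, k % 8)).2.1 + k % 8))) (fun q hq => by
        have h3 := hg q hq
        have h4 := hf (8 * QCirc.enc (U.run (k / 8, a, k % 8)).2.1 + k % 8)
        rw [Nat.succ_mul] at h3
        rw [Function.update_apply]
        split_ifs with h
        · rw [← h]; omega
        · omega)
    have h3 := Runs.loop_pos (i := 11) (W := w + 1) (by
      simp only [List.getD_cons_succ, List.getD_cons_zero]
      positivity) (by exact lenk1) h1 h2
    rw [pathLoopTime_succ] at h3
    refine ⟨g', h3, h2', fun q => ?_⟩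
    rw [h2'', QCirc.pairCount, QCirc.pairCount, Finset.sum_range_succ, Function.update_apply]
    simp only [eq_comm (a := q)]
    split_ifs with h
    · subst h; ring
    · ring

end RAM

/-! ### Preparation: memory layout, decoding of the bit strings, choice of the cut, output. -/

namespace RAM

theorem Bounded.of_regs {W : ℕ} {M : ℕ → ℤ} {S ph z addr cnt d L x A B Y X p m T G : ℤ}
    (hW : 1 ≤ W) (hM : ∀ n, len (M n) ≤ W)
    (h : ∀ v ∈ [S, ph, z, addr, cnt, d, L, x, A, B, Y, X, p, m, T, G], len v ≤ W) :
    Bounded W (regs S ph z addr cnt d L x A B Y X p m T G, M) := by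
  have h0 : len 0 ≤ W := hW
  refine ⟨?_, hM⟩
  simp only [List.forall_mem_cons, List.not_mem_nil, false_imp_iff, implies_true, and_true] at h ⊢
  obtain ⟨h4, h5, h6, h7, h8, h9, h10, h11, h12, h13, h14, h15, h16, h17, h18, h20⟩ := h
  exact ⟨h0, h0, h0, h0, h4, h5, h6, h7, h8, h9, h10, h11, h12, h13, h14, h15, h16, h17, h18, h0,
    h20⟩

/-- Compute the layout of the memory from the first two cells of the input. -/
def setup : Prog := block
  [.load 15 0, .const 2 1, .load 17 2, .const 7 2, .arith .add 20 7 15, .arith .add 20 20 15,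
   .const 3 3, .arith .mul 10 3 17, .arith .add 10 20 10, .move 6 10, .const 14 1, .move 8 15,
   .arith .add 18 10 15, .const 2 0, .const 3 0]

theorem eval_setup {M : ℕ → ℤ} {N m : ℤ} (hN : M 0 = N) (hm : M 1 = m) :
    setup.eval (regs 0 0 0 0 0 0 0 0 0 0 0 0 0 0 0 0, M) =
      (regs 0 0 (2 + N + N + 3 * m) 2 N 0 (2 + N + N + 3 * m) 0 0 0 1 N 0 m
        (2 + N + N + 3 * m + N) (2 + N + N), M) := by
  simp [setup, block, Prog.eval, Op.eval, hN, hm]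

/-- Read one bit of each bit string and store one power of two. -/
def bitsBody : Prog := block
  [.load 0 7, .arith .mul 0 0 14, .arith .add 12 12 0,
   .arith .add 0 7 15, .load 0 0, .arith .mul 0 0 14, .arith .add 13 13 0,
   .store 6 14, .arith .add 14 14 14,
   .const 3 1, .arith .add 7 7 3, .arith .add 6 6 3, .arith .sub 8 8 3, .const 0 0, .const 3 0]

/-- The memory `M` with the first `i` powers of two from address `L` on. -/
def withPowers (M : ℕ → ℤ) (L i : ℕ) : ℕ → ℤ := fun n =>
  if L ≤ n ∧ n < L + i then 2 ^ (n - L) else M n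

theorem update_withPowers (M : ℕ → ℤ) (L i : ℕ) :
    Function.update (withPowers M L i) (L + i) (2 ^ i) = withPowers M L (i + 1) := by
  funext n
  simp only [withPowers, Function.update_apply]
  split_ifs with h1 h2 h3 h4 h5
  · rw [h1, Nat.add_sub_cancel_left]
  all_goals first | rfl | omega

/-- The number with binary digits `f 0, …, f (i - 1)`. -/
def binary (f : ℕ → ℤ) (i : ℕ) : ℤ := ∑ j ∈ Finset.range i, f j * 2 ^ j

theorem binary_bounds {f : ℕ → ℤ} {i : ℕ} (hf : ∀ j < i, 0 ≤ f j ∧ f j ≤ 1) :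
    0 ≤ binary f i ∧ binary f i < 2 ^ i := by
  induction i with
  | zero => simp [binary]
  | succ i ih =>
    obtain ⟨h1, h2⟩ := ih fun j hj => hf j (by omega)
    obtain ⟨h3, h4⟩ := hf i (by omega)
    have h5 : (0 : ℤ) < 2 ^ i := by positivity
    rw [binary, Finset.sum_range_succ, ← binary, pow_succ]
    constructor <;> nlinarith

theorem eval_bitsBody (M : ℕ → ℤ) {L N : ℕ} (i : ℕ) (hi : i < N) (hL : 2 + N + N ≤ L)
    (k m T G : ℤ) :
    bitsBody.eval (regs 0 0 ((L + i : ℕ) : ℤ) ((2 + i : ℕ) : ℤ) (k + 1) 0 L 0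
        (binary (fun j => M (2 + j)) i) (binary (fun j => M (2 + N + j)) i) (2 ^ i) N 0 m T G,
        withPowers M L i) =
      (regs 0 0 ((L + (i + 1) : ℕ) : ℤ) ((2 + (i + 1) : ℕ) : ℤ) k 0 L 0
        (binary (fun j => M (2 + j)) (i + 1)) (binary (fun j => M (2 + N + j)) (i + 1))
        (2 ^ (i + 1)) N 0 m T G, withPowers M L (i + 1)) := by
  have e1 : withPowers M L i (2 + i) = M (2 + i) := if_neg (by omega)
  have e2 : withPowers M L i (2 + N + i) = M (2 + N + i) := if_neg (by omega)
  have e3 : (((2 + i : ℕ) : ℤ) + N).toNat = 2 + N + i := by omega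
  have hz : ((L + i : ℕ) : ℤ) + 1 = ((L + (i + 1) : ℕ) : ℤ) := by push_cast; ring
  have hadd : ((2 + i : ℕ) : ℤ) + 1 = ((2 + (i + 1) : ℕ) : ℤ) := by push_cast; ring
  have hbin (f : ℕ → ℤ) : binary f i + f i * 2 ^ i = binary f (i + 1) :=
    (Finset.sum_range_succ ..).symm
  have hA := hbin fun j => M (2 + j)
  have hB := hbin fun j => M (2 + N + j)
  have hp : (2 : ℤ) ^ i + 2 ^ i = 2 ^ (i + 1) := by rw [pow_succ, mul_two]
  simp only [bitsBody, block, Prog.eval, Op.eval, List.set_cons_succ, List.set_cons_zero,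
    List.getD_cons_succ, List.getD_cons_zero, Int.toNat_natCast, e1, e2, e3, update_withPowers,
    hz, hadd, hA, hB, hp, add_sub_cancel_right]

/-- After `i` rounds the registers hold the numbers formed by the first `i` bits of both strings,
and `i` powers of two are stored. The powers start at `L`, behind the bits, so the writes do not
disturb the bits still to be read. -/
theorem runs_bitsLoop {M : ℕ → ℤ} {L N w : ℕ} (hL : 2 + N + N ≤ L) {m T G : ℤ}
    (hLw : L + N < 2 ^ w) (hNw : N < w)
    (hm : len m ≤ w + 1) (hT : len T ≤ w + 1) (hG : len G ≤ w + 1) (hM : ∀ n, len (M n) ≤ w + 1)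
    (ha : ∀ j < N, 0 ≤ M (2 + j) ∧ M (2 + j) ≤ 1)
    (hb : ∀ j < N, 0 ≤ M (2 + N + j) ∧ M (2 + N + j) ≤ 1) (k i : ℕ) (hi : i + k = N) :
    Runs (.loop 8 bitsBody)
      (regs 0 0 ((L + i : ℕ) : ℤ) ((2 + i : ℕ) : ℤ) k 0 L 0
        (binary (fun j => M (2 + j)) i) (binary (fun j => M (2 + N + j)) i) (2 ^ i) N 0 m T G,
        withPowers M L i)
      (regs 0 0 ((L + N : ℕ) : ℤ) ((2 + N : ℕ) : ℤ) 0 0 L 0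
        (binary (fun j => M (2 + j)) N) (binary (fun j => M (2 + N + j)) N) (2 ^ N) N 0 m T G,
        withPowers M L N)
      (k * (w + 1 + bitsBody.costFactor * (w + 1) ^ 2) + (w + 1)) := by
  induction k generalizing i with
  | zero =>
    obtain rfl : i = N := hi
    rw [zero_mul, zero_add]
    exact .loop_nonpos (by simp) (by simp [len])
  | succ k ih =>
    have hNN : 2 ^ N < 2 ^ w := Nat.pow_lt_pow_right one_lt_two hNw
    have hlenk : len ((k + 1 : ℕ) : ℤ) ≤ w + 1 := len_le_of_nat_lt (by omega)
    have hiN : (2 : ℕ) ^ i ≤ 2 ^ N := Nat.pow_le_pow_right two_pos (by omega)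
    have hiN' : (2 : ℤ) ^ i < 2 ^ w := by exact_mod_cast hiN.trans_lt hNN
    have hbin {f : ℕ → ℤ} (hf : ∀ j < N, 0 ≤ f j ∧ f j ≤ 1) : len (binary f i) ≤ w + 1 := by
      obtain ⟨h1, h2⟩ := binary_bounds (f := f) (i := i) fun j hj => hf j (by omega)
      exact len_le_iff.2 (by rw [abs_of_nonneg h1]; exact h2.trans hiN')
    have hpow (j : ℕ) (hj : j < w) : len (2 ^ j) ≤ w + 1 := len_le_iff.2 (by
      rw [abs_of_nonneg (by positivity)]
      exact pow_lt_pow_right₀ one_lt_two hj)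
    have hmem (n : ℕ) : len (withPowers M L i n) ≤ w + 1 := by
      rw [withPowers]
      split_ifs with h
      · exact hpow _ (by omega)
      · exact hM n
    have hev := eval_bitsBody M i (by omega) hL k m T G
    rw [← Nat.cast_succ] at hev
    have h1 := Runs.straight (P := bitsBody) (n := 21) (W := w + 1) (by decide) rfl (Nat.le_add_left 1 w)
      (.of_regs (Nat.le_add_left 1 w) hmem (by
        have h0 : len 0 ≤ w + 1 := Nat.le_add_left 1 w
        have h2 : len ((L + i : ℕ) : ℤ) ≤ w + 1 := len_le_of_nat_lt (by omega)
        have h3 : len ((2 + i : ℕ) : ℤ) ≤ w + 1 := len_le_of_nat_lt (by omega)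
        have h4 : len (L : ℤ) ≤ w + 1 := len_le_of_nat_lt (by omega)
        have h5 : len (N : ℤ) ≤ w + 1 := len_le_of_nat_lt (by omega)
        have h6 := hbin ha
        have h7 := hbin hb
        have h8 := hpow i (by omega)
        simp only [List.forall_mem_cons, List.not_mem_nil, false_imp_iff, implies_true, and_true]
        exact ⟨h0, h0, h2, h3, hlenk, h0, h4, h0, h6, h7, h8, h5, h0, hm, hT, hG⟩))
      hev
    have h2 := Runs.loop_pos (i := 8) (W := w + 1) (by
      simp only [List.getD_cons_succ, List.getD_cons_zero]
      positivity) (by exact hlenk) h1 (ih (i + 1) (by omega))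
    refine h2.mono (le_of_eq ?_)
    ring

/-- Start the count of the Hadamard gates. -/
def countStart : Prog := block [.move 7 20, .move 8 17, .const 15 1, .const 6 0]

/-- Double `r 15` if the next gate is a Hadamard gate. -/
def countBody : Prog := block
  [.load 0 7, .cond 0 .skip (.arith .add 15 15 15), .const 3 3, .arith .add 7 7 3,
   .const 3 1, .arith .sub 8 8 3, .const 0 0, .const 3 0]

theorem eval_countBody {N : ℕ} {M : ℕ → ℤ} {addr : ℤ} {g : QCirc.Gate N} (hg : GateAt M addr g)
    (cnt L A B Y X p m T G : ℤ) :
    countBody.eval (regs 0 0 0 addr cnt 0 L 0 A B Y X p m T G, M) =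
      (regs 0 0 0 (addr + 3) (cnt - 1) 0 L 0 A B Y (X * if g.isH then 2 else 1) p m T G, M) := by
  cases g with
  | H i | T i | CZ i j hij =>
    simp only [GateAt, QCirc.Gate.encode, List.cons.injEq, and_true] at hg
    simp [countBody, block, Prog.eval, Op.eval, hg.1, QCirc.Gate.isH, mul_two]

/-- The count `c` is kept as `2 ^ c`, which is directly the number of paths needed later as a loop
bound. -/
theorem runs_countLoop {N w : ℕ} {M : ℕ → ℤ} {L A B Y p m T G : ℤ}
    (hB : ∀ addr, len addr ≤ w + 1 → ∀ cnt, len cnt ≤ w + 1 → ∀ X, len X ≤ w + 1 →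
      Bounded (w + 1) (regs 0 0 0 addr cnt 0 L 0 A B Y X p m T G, M))
    (U : QCirc.Circuit N) (addr c : ℕ) (hlen : addr + 3 * U.length < 2 ^ w)
    (hc : c + U.length < w) (hU : ∀ (k : ℕ) (hk : k < U.length), GateAt M (addr + 3 * k) U[k]) :
    Runs (.loop 8 countBody)
      (regs 0 0 0 addr U.length 0 L 0 A B Y (2 ^ c) p m T G, M)
      (regs 0 0 0 ((addr + 3 * U.length : ℕ) : ℤ) 0 0 L 0 A B Y (2 ^ (c + U.numH)) p m T G, M)
      (U.length * (w + 1 + countBody.costFactor * (w + 1) ^ 2) + (w + 1)) := by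
  induction U generalizing addr c with
  | nil =>
    simp only [List.length_nil, mul_zero, add_zero, zero_mul, zero_add, QCirc.Circuit.numH,
      List.countP_nil]
    exact .loop_nonpos (by simp) (by simp [len])
  | cons g U ih =>
    rw [List.length_cons] at hlen hc
    have hcnt : len ((g :: U).length : ℤ) ≤ w + 1 :=
      len_le_of_nat_lt (by rw [List.length_cons]; omega)
    have hX : len (2 ^ c) ≤ w + 1 := len_le_iff.2 (by
      rw [abs_of_nonneg (by positivity)]
      exact pow_lt_pow_right₀ one_lt_two (by omega))
    have hg : GateAt M addr g := by
      have := hU 0 (Nat.succ_pos _)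
      rwa [Nat.cast_zero, mul_zero, add_zero] at this
    have h1 := Runs.straight (P := countBody) (n := 21) (by decide) rfl (Nat.le_add_left 1 w)
      (hB addr (len_le_of_nat_lt (by omega)) (g :: U).length hcnt (2 ^ c) hX)
      (eval_countBody hg _ L A B Y _ p m T G)
    have h2 := ih (addr + 3) (c + if g.isH then 1 else 0) (by omega) (by split_ifs <;> omega)
      (fun k hk => by
        have := hU (k + 1) (by simpa using hk)
        rw [List.getElem_cons_succ] at this
        convert this using 1
        push_cast
        ring)
    have e1 : (((g :: U).length : ℕ) : ℤ) - 1 = U.length := by simp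
    have e2 : (addr : ℤ) + 3 = ((addr + 3 : ℕ) : ℤ) := by push_cast; rfl
    have e3 : (2 : ℤ) ^ c * (if g.isH then 2 else 1) = 2 ^ (c + if g.isH then 1 else 0) := by
      split_ifs <;> simp [pow_succ]
    have e4 : addr + 3 * (g :: U).length = addr + 3 + 3 * U.length := by
      rw [List.length_cons]; ring
    have e5 : c + QCirc.Circuit.numH (g :: U) =
        (c + if g.isH then 1 else 0) + QCirc.Circuit.numH U := by
      rw [QCirc.Circuit.numH_cons]; ring
    rw [e1, e2, e3] at h1
    rw [e4, e5]
    refine (Runs.loop_pos (W := w + 1) ?_ ?_ h1 h2).mono (le_of_eq ?_)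
    · simp only [List.length_cons, List.getD_cons_succ, List.getD_cons_zero]
      positivity
    · exact hcnt
    · rw [List.length_cons]
      ring

/-- Start the search for the middle of the circuit. -/
def splitStart : Prog := block [.move 7 20, .const 14 1, .arith .sub 0 15 14]

/-- Move the next gate to the first part of the circuit. -/
def splitBody : Prog := block
  [.load 0 7,
   .cond 0 .skip (block [.arith .add 14 14 14, .const 3 2, .arith .div 15 15 3]),
   .const 3 3, .arith .add 7 7 3, .const 3 1, .arith .add 16 16 3, .const 3 0,
   .arith .sub 0 15 14]

/-- Register `0` carries the loop test, the difference of the two path numbers, between rounds; this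
is why the state is a `regs` with entry `0` overwritten. -/
theorem eval_splitBody {N : ℕ} {M : ℕ → ℤ} {addr : ℤ} {g : QCirc.Gate N} (hg : GateAt M addr g)
    (v L A B p m T G : ℤ) (c h : ℕ) :
    splitBody.eval ((regs 0 0 0 addr 0 0 L 0 A B (2 ^ c) (2 ^ (h + if g.isH then 1 else 0)) p m T
        G).set 0 v, M) =
      ((regs 0 0 0 (addr + 3) 0 0 L 0 A B (2 ^ (c + if g.isH then 1 else 0)) (2 ^ h) (p + 1) m T
        G).set 0 (2 ^ h - 2 ^ (c + if g.isH then 1 else 0)), M) := by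
  cases g with
  | H i | T i | CZ i j hij =>
    simp only [GateAt, QCirc.Gate.encode, List.cons.injEq, and_true] at hg
    simp [splitBody, block, Prog.eval, Op.eval, hg.1, QCirc.Gate.isH, ← mul_two, pow_succ]

/-- The loop moves gates to the first part while that part has fewer Hadamard gates than the rest. A
single gate changes the difference by 0 or 2, so at the end the first part is ahead by at most one;
`hc` is this invariant. -/
theorem runs_splitLoop {N w : ℕ} {M : ℕ → ℤ} {L A B m T G : ℤ}
    (hB : ∀ addr, len addr ≤ w + 1 → ∀ Y, len Y ≤ w + 1 → ∀ X, len X ≤ w + 1 →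
      ∀ p, len p ≤ w + 1 → Bounded (w + 1) (regs 0 0 0 addr 0 0 L 0 A B Y X p m T G, M))
    (U : QCirc.Circuit N) (addr c p : ℕ) (hlen : addr + 3 * U.length < 2 ^ w)
    (hp : p + U.length < 2 ^ w) (hw : U.length + 2 < w) (hc : c ≤ U.numH + 1)
    (hU : ∀ (k : ℕ) (hk : k < U.length), GateAt M (addr + 3 * k) U[k]) :
    ∃ (V V' : QCirc.Circuit N) (addr' v : ℤ), U = V ++ V' ∧ V'.numH ≤ c + V.numH ∧
      c + V.numH ≤ V'.numH + 1 ∧ len addr' ≤ w + 1 ∧ len v ≤ w + 1 ∧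
      Runs (.loop 0 splitBody)
        ((regs 0 0 0 addr 0 0 L 0 A B (2 ^ c) (2 ^ U.numH) p m T G).set 0 (2 ^ U.numH - 2 ^ c), M)
        ((regs 0 0 0 addr' 0 0 L 0 A B (2 ^ (c + V.numH)) (2 ^ V'.numH) ((p + V.length : ℕ) : ℤ)
          m T G).set 0 v, M)
        (U.length * (w + 1 + splitBody.costFactor * (w + 1) ^ 2) + (w + 1)) := by
  have hpow (j : ℕ) (hj : j < w) : len (2 ^ j) ≤ w + 1 := len_le_iff.2 (by
    rw [abs_of_nonneg (by positivity)]
    exact pow_lt_pow_right₀ one_lt_two hj)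
  have hHw := U.numH_le
  have hlenv : len (2 ^ U.numH - 2 ^ c) ≤ w + 1 := by
    refine len_le_iff.2 (abs_sub_lt_of_nonneg_of_lt (by positivity) ?_ (by positivity) ?_) <;>
    exact pow_lt_pow_right₀ one_lt_two (by omega)
  have haddr : len (addr : ℤ) ≤ w + 1 := len_le_of_nat_lt (by omega)
  induction U generalizing addr c p with
  | nil =>
    refine ⟨[], [], addr, _, rfl, Nat.zero_le _, hc, haddr, hlenv, ?_⟩
    rw [List.length_nil, zero_mul, zero_add]
    -- No gates remain, so the test value is `1 - 2 ^ c`, which is never positive.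
    refine .loop_nonpos ?_ hlenv
    simp only [List.set_cons_zero, List.getD_cons_zero, QCirc.Circuit.numH, List.countP_nil,
      pow_zero, sub_nonpos]
    exact one_le_pow₀ one_le_two
  | cons g U ih =>
    rcases le_or_gt (QCirc.Circuit.numH (g :: U)) c with hle | hlt
    · refine ⟨[], g :: U, addr, _, rfl, hle, hc, haddr, hlenv, ?_⟩
      refine Runs.mono (.loop_nonpos ?_ hlenv) (Nat.le_add_left _ _)
      simp only [List.set_cons_zero, List.getD_cons_zero, sub_nonpos]
      exact pow_le_pow_right₀ one_le_two hle
    · have hg : GateAt M addr g := by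
        have := hU 0 (Nat.succ_pos _)
        rwa [Nat.cast_zero, mul_zero, add_zero] at this
      have hpos : 0 < (2 : ℤ) ^ QCirc.Circuit.numH (g :: U) - 2 ^ c :=
        sub_pos.2 (pow_lt_pow_right₀ one_lt_two hlt)
      rw [QCirc.Circuit.numH_cons] at hlt hlenv hpos hHw ⊢
      rw [List.length_cons] at hlen hp hw hHw
      have hUle := QCirc.Circuit.numH_le U
      have h1 := Runs.straight (P := splitBody) (n := 21) (by decide) rfl (Nat.le_add_left 1 w)
        (((hB addr haddr _ (hpow c (by omega)) _ (hpow _ (by omega)) p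
          (len_le_of_nat_lt (by omega))).set hlenv 0))
        (eval_splitBody hg _ L A B p m T G c (QCirc.Circuit.numH U))
      obtain ⟨V, V', addr', v, h2, h3, h4, h5, h6, h7⟩ :=
        ih (addr + 3) (c + if g.isH then 1 else 0) (p + 1) (by omega) (by omega) (by omega)
          (by split_ifs at * <;> omega) (fun k hk => by
            have := hU (k + 1) (by simpa using hk)
            rw [List.getElem_cons_succ] at this
            convert this using 1
            push_cast
            ring) hUle
          (by
            refine len_le_iff.2 (abs_sub_lt_of_nonneg_of_lt (by positivity) ?_ (by positivity) ?_)
              <;> exact pow_lt_pow_right₀ one_lt_two (by split_ifs at * <;> omega))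
          (len_le_of_nat_lt (by omega))
      have e1 : (addr : ℤ) + 3 = ((addr + 3 : ℕ) : ℤ) := by push_cast; rfl
      have e2 : (p : ℤ) + 1 = ((p + 1 : ℕ) : ℤ) := by push_cast; rfl
      have e3 : c + QCirc.Circuit.numH (g :: V) =
          (c + if g.isH then 1 else 0) + QCirc.Circuit.numH V := by
        rw [QCirc.Circuit.numH_cons]; ring
      have e4 : p + (g :: V).length = p + 1 + V.length := by rw [List.length_cons]; ring
      rw [e1, e2] at h1
      refine ⟨g :: V, V', addr', v, by rw [h2]; rfl, by rw [e3]; exact h3, by rw [e3]; exact h4,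
        h5, h6, ?_⟩
      rw [e3, e4]
      refine (Runs.loop_pos (W := w + 1) (by exact hpos) (by exact hlenv) h1 h7).mono (le_of_eq ?_)
      rw [List.length_cons]
      ring

/-- Start the loop over the paths through the first part of the circuit. -/
def forwardInit : Prog := block [.const 0 0, .const 7 0, .move 11 14]

/-- Start the loop over the paths through the second part of the circuit. -/
def backwardInit : Prog := block
  [.const 3 8, .arith .mul 11 3 15, .arith .sub 16 17 16, .const 14 0, .const 3 0]

/-- Move the four coefficients to the first four registers. -/
def output : Prog := block
  [.const 5 4,
   .arith .add 4 0 18, .load 0 4, .arith .add 4 4 5, .load 4 4, .arith .sub 0 0 4,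
   .const 4 1, .arith .add 4 4 18, .load 1 4, .arith .add 4 4 5, .load 4 4, .arith .sub 1 1 4,
   .const 4 2, .arith .add 4 4 18, .load 2 4, .arith .add 4 4 5, .load 4 4, .arith .sub 2 2 4,
   .const 4 3, .arith .add 4 4 18, .load 3 4, .arith .add 4 4 5, .load 4 4, .arith .sub 3 3 4]

theorem eval_output (base : ℕ → ℤ) (g f : ℕ → ℕ) (T : ℕ) (L A B X p m G : ℤ) (j : Fin 4) :
    (output.eval (regs 0 0 0 0 0 0 L 0 A B 0 X p m T G, lay T base g f)).1.getD j 0 =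
      g j - g (j + 4) := by
  have e0 : ((0 : ℤ) + T).toNat = T + 0 := by omega
  have e1 : ((1 : ℤ) + T).toNat = T + 1 := by omega
  have e2 : ((2 : ℤ) + T).toNat = T + 2 := by omega
  have e3 : ((3 : ℤ) + T).toNat = T + 3 := by omega
  have e4 : ((0 : ℤ) + T + 4).toNat = T + 4 := by omega
  have e5 : ((1 : ℤ) + T + 4).toNat = T + 5 := by omega
  have e6 : ((2 : ℤ) + T + 4).toNat = T + 6 := by omega
  have e7 : ((3 : ℤ) + T + 4).toNat = T + 7 := by omega
  simp only [output, block, Prog.eval, Op.eval, List.set_cons_succ, List.set_cons_zero,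
    List.getD_cons_succ, List.getD_cons_zero, e0, e1, e2, e3, e4, e5, e6, e7,
    lay_counter T base g f (show 0 < 8 by norm_num), lay_counter T base g f (show 1 < 8 by norm_num),
    lay_counter T base g f (show 2 < 8 by norm_num), lay_counter T base g f (show 3 < 8 by norm_num),
    lay_counter T base g f (show 4 < 8 by norm_num), lay_counter T base g f (show 5 < 8 by norm_num),
    lay_counter T base g f (show 6 < 8 by norm_num), lay_counter T base g f (show 7 < 8 by norm_num)]
  fin_cases j <;> simp

/-- The program that computes the amplitude. -/
def amplitudeProg : Prog :=
  .seq setup (.seq (.loop 8 bitsBody) (.seq countStart (.seq (.loop 8 countBody)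
    (.seq splitStart (.seq (.loop 0 splitBody) (.seq forwardInit (.seq (.loop 11 forwardBody)
      (.seq backwardInit (.seq (.loop 11 backwardBody) output)))))))))

end RAM

/-! ### Positions and sizes of the entries of the encoded input. -/

namespace QCirc

theorem encodeInput_eq {N : ℕ} (U : Circuit N) (a b : Bits N) :
    encodeInput U a b = (N : ℤ) :: (U.length : ℤ) ::
      (encodeBits a ++ (encodeBits b ++ U.flatMap Gate.encode)) := by
  simp [encodeInput]

theorem getD_encodeBits_append {N : ℕ} (a : Bits N) (l : List ℤ) (j : Fin N) :
    (encodeBits a ++ l).getD j 0 = ((a j : ℕ) : ℤ) := by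
  rw [List.getD_append _ _ _ _ (by simp [encodeBits])]
  simp [encodeBits]

theorem getD_encodeBits_append_right {N : ℕ} (a : Bits N) (l : List ℤ) (j : ℕ) :
    (encodeBits a ++ l).getD (N + j) 0 = l.getD j 0 := by
  rw [List.getD_append_right _ _ _ _ (by simp [encodeBits])]
  simp [encodeBits]

theorem getD_encodeInput_left {N : ℕ} (U : Circuit N) (a b : Bits N) (j : Fin N) :
    (encodeInput U a b).getD (2 + j) 0 = ((a j : ℕ) : ℤ) := by
  rw [encodeInput_eq, show 2 + (j : ℕ) = j + 1 + 1 by ring, List.getD_cons_succ,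
    List.getD_cons_succ, getD_encodeBits_append]

theorem getD_encodeInput_right {N : ℕ} (U : Circuit N) (a b : Bits N) (j : Fin N) :
    (encodeInput U a b).getD (2 + N + j) 0 = ((b j : ℕ) : ℤ) := by
  rw [encodeInput_eq, show 2 + N + (j : ℕ) = N + j + 1 + 1 by ring, List.getD_cons_succ,
    List.getD_cons_succ, getD_encodeBits_append_right, getD_encodeBits_append]

theorem getD_encodeInput_gates {N : ℕ} (U : Circuit N) (a b : Bits N) (j : ℕ) :
    (encodeInput U a b).getD (2 + N + N + j) 0 = (U.flatMap Gate.encode).getD j 0 := by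
  rw [encodeInput_eq, show 2 + N + N + j = N + (N + j) + 1 + 1 by ring, List.getD_cons_succ,
    List.getD_cons_succ, getD_encodeBits_append_right, getD_encodeBits_append_right]

theorem Gate.length_encode {N : ℕ} (g : Gate N) : g.encode.length = 3 := by cases g <;> rfl

theorem length_flatMap_encode {N : ℕ} (U : Circuit N) :
    (U.flatMap Gate.encode).length = 3 * U.length := by
  induction U with
  | nil => rfl
  | cons g U ih =>
    rw [List.flatMap_cons, List.length_append, ih, g.length_encode, List.length_cons]
    ring

theorem length_encodeInput {N : ℕ} (U : Circuit N) (a b : Bits N) :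
    (encodeInput U a b).length = 2 + N + N + 3 * U.length := by
  rw [encodeInput_eq, List.length_cons, List.length_cons, List.length_append, List.length_append,
    length_flatMap_encode]
  simp only [encodeBits, List.length_ofFn]
  ring

theorem getD_flatMap_encode {N : ℕ} (U : Circuit N) (k : ℕ) (hk : k < U.length) {c : ℕ}
    (hc : c < 3) : (U.flatMap Gate.encode).getD (3 * k + c) 0 = (U[k]).encode.getD c 0 := by
  induction U generalizing k with
  | nil => exact absurd hk (Nat.not_lt_zero k)
  | cons g U ih =>
    rw [List.flatMap_cons]
    cases k with
    | zero =>
      rw [List.getD_append _ _ _ _ (by rw [g.length_encode]; omega), mul_zero, zero_add]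
      rfl
    | succ k =>
      rw [List.getD_append_right _ _ _ _ (by rw [g.length_encode]; omega), g.length_encode,
        show 3 * (k + 1) + c - 3 = 3 * k + c by omega, ih k (by simpa using hk)]
      rfl

theorem abs_le_of_mem_encodeInput {N : ℕ} (U : Circuit N) (a b : Bits N) {v : ℤ}
    (hv : v ∈ encodeInput U a b) : |v| ≤ N + U.length + 2 := by
  have hbit {a : Bits N} (h : v ∈ encodeBits a) : |v| ≤ N + U.length + 2 := by
    rw [encodeBits, List.mem_ofFn] at h
    obtain ⟨i, rfl⟩ := h
    have := (a i).isLt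
    rw [Nat.abs_cast]
    omega
  simp only [encodeInput_eq, List.mem_cons, List.mem_append, List.mem_flatMap] at hv
  rcases hv with rfl | rfl | h | h | ⟨g, -, h⟩
  · rw [Nat.abs_cast]; omega
  · rw [Nat.abs_cast]; omega
  · exact hbit h
  · exact hbit h
  · have hi (i : Fin N) : |((i : ℕ) : ℤ)| ≤ N + U.length + 2 := by
      have := i.isLt
      rw [Nat.abs_cast]
      omega
    cases g with
    | H i | T i =>
      simp only [Gate.encode, List.mem_cons, List.not_mem_nil, or_false] at h
      rcases h with rfl | rfl | rfl <;> first | exact hi i | (norm_num; omega)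
    | CZ i j =>
      simp only [Gate.encode, List.mem_cons, List.not_mem_nil, or_false] at h
      rcases h with rfl | rfl | rfl <;> first | exact hi i | exact hi j | (norm_num; omega)

end QCirc

/-! ### Correctness and running time of the whole program. -/

namespace RAM

theorem gateAt_encodeInput {N : ℕ} (U : QCirc.Circuit N) (a b : QCirc.Bits N) {M : ℕ → ℤ}
    (hM : ∀ n < 2 + N + N + 3 * U.length, M n = (QCirc.encodeInput U a b).getD n 0)
    (k : ℕ) (hk : k < U.length) : GateAt M ((2 + N + N + 3 * k : ℕ) : ℤ) U[k] := by
  have h (c : ℕ) (hc : c < 3) :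
      M (2 + N + N + (3 * k + c)) = (U[k]).encode.getD c 0 := by
    rw [hM _ (by omega), QCirc.getD_encodeInput_gates, QCirc.getD_flatMap_encode U k hk hc]
  have h0 := h 0 (by norm_num)
  have h1 := h 1 (by norm_num)
  have h2 := h 2 (by norm_num)
  have e0 : ((2 + N + N + 3 * k : ℕ) : ℤ).toNat = 2 + N + N + (3 * k + 0) := by omega
  have e1 : (((2 + N + N + 3 * k : ℕ) : ℤ) + 1).toNat = 2 + N + N + (3 * k + 1) := by omega
  have e2 : (((2 + N + N + 3 * k : ℕ) : ℤ) + 1 + 1).toNat = 2 + N + N + (3 * k + 2) := by omega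
  rw [GateAt, e0, e1, e2, h0, h1, h2]
  cases U[k] <;> rfl

theorem powersAt_lay {N L T : ℕ} (hT : L + N ≤ T) (M : ℕ → ℤ) (g f : ℕ → ℕ) :
    PowersAt N (lay T (withPowers M L N) g f) L := by
  intro i
  have hi := i.isLt
  have e : (((i : ℕ) : ℤ) + L).toNat = L + i := by omega
  rw [e, lay, if_pos (by omega), withPowers, if_pos (by omega), Nat.add_sub_cancel_left]

theorem binary_eq_enc {N : ℕ} (s : QCirc.Bits N) {f : ℕ → ℤ}
    (hf : ∀ j : Fin N, f j = ((s j : ℕ) : ℤ)) : binary f N = QCirc.enc s := by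
  rw [binary, Finset.sum_range, QCirc.enc_eq_sum]
  push_cast
  exact Finset.sum_congr rfl fun j _ => by rw [hf]

/-- The constant in the time bound for `amplitudeProg`. -/
def timeConst : ℕ :=
  setup.costFactor + bitsBody.costFactor + countStart.costFactor + countBody.costFactor +
    splitStart.costFactor + splitBody.costFactor + forwardInit.costFactor +
    forwardStart.costFactor + forwardEnd.costFactor + backwardInit.costFactor +
    backwardStart.costFactor + backwardEnd.costFactor + output.costFactor +
    2 * gateStep.costFactor + 20

theorem loopTime_le {n W c : ℕ} (hn : n ≤ W) (hW : 1 ≤ W) :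
    n * (W + c * W ^ 2) + W ≤ (c + 2) * W ^ 3 := by
  have h1 : n * (W + c * W ^ 2) ≤ W * (W + c * W ^ 2) := Nat.mul_le_mul_right _ hn
  have h2 : W ^ 2 ≤ W ^ 3 := Nat.pow_le_pow_right hW (by norm_num)
  have h3 : W ≤ W ^ 3 := Nat.le_self_pow (by norm_num) W
  calc _ ≤ W ^ 2 + c * W ^ 3 + W := by nlinarith
    _ ≤ _ := by nlinarith

/-- Following one path costs `O(W ^ 3)`: at most `W` gates at `O(W ^ 2)` each. The `k + 1` covers
the final test of the loop. -/
theorem pathLoopTime_le {P Q : Prog} {n W k : ℕ} (hn : n ≤ W) (hW : 1 ≤ W) :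
    pathLoopTime P Q n W k ≤
      (P.costFactor + Q.costFactor + gateStep.costFactor + 4) * W ^ 3 * (k + 1) := by
  have h1 := loopTime_le (c := gateStep.costFactor) hn hW
  have h2 : W ^ 2 ≤ W ^ 3 := Nat.pow_le_pow_right hW (by norm_num)
  have h3 : W ≤ W ^ 3 := Nat.le_self_pow (by norm_num) W
  have h4 : W + pathTime P Q n W ≤
      (P.costFactor + Q.costFactor + gateStep.costFactor + 4) * W ^ 3 := by
    rw [pathTime, gateLoopTime]
    nlinarith [Nat.mul_le_mul_left P.costFactor h2, Nat.mul_le_mul_left Q.costFactor h2]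
  have h5 : W ≤ (P.costFactor + Q.costFactor + gateStep.costFactor + 4) * W ^ 3 := by nlinarith
  rw [pathLoopTime, mul_add_one, mul_comm _ k]
  exact add_le_add (Nat.mul_le_mul_left k h4) h5

theorem time_sum_le {W x y t₁ t₂ t₃ t₄ t₅ t₆ t₇ t₈ t₉ t₁₀ t₁₁ c₁ c₂ c₃ c₄ c₅ c₆ c₇ c₈ c₉ c₁₀ c₁₁ : ℕ}
    (h₁ : t₁ ≤ c₁ * W) (h₂ : t₂ ≤ c₂ * W) (h₃ : t₃ ≤ c₃ * W) (h₄ : t₄ ≤ c₄ * W) (h₅ : t₅ ≤ c₅ * W)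
    (h₆ : t₆ ≤ c₆ * W) (h₇ : t₇ ≤ c₇ * W) (h₈ : t₈ ≤ c₈ * W * (x + 1)) (h₉ : t₉ ≤ c₉ * W)
    (h₁₀ : t₁₀ ≤ c₁₀ * W * (y + 1)) (h₁₁ : t₁₁ ≤ c₁₁ * W) :
    t₁ + (t₂ + (t₃ + (t₄ + (t₅ + (t₆ + (t₇ + (t₈ + (t₉ + (t₁₀ + t₁₁))))))))) ≤
      (c₁ + c₂ + c₃ + c₄ + c₅ + c₆ + c₇ + c₈ + c₉ + c₁₀ + c₁₁) * W * (x + y + 1) := by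
  have h (c : ℕ) : c * W ≤ c * W * (x + y + 1) := Nat.le_mul_of_pos_right _ (by omega)
  have hx : c₈ * W * (x + 1) ≤ c₈ * W * (x + y + 1) := Nat.mul_le_mul_left _ (by omega)
  have hy : c₁₀ * W * (y + 1) ≤ c₁₀ * W * (x + y + 1) := Nat.mul_le_mul_left _ (by omega)
  simp only [add_mul _ _ W, add_mul _ _ (x + y + 1)]
  have e₁ := h c₁
  have e₂ := h c₂
  have e₃ := h c₃
  have e₄ := h c₄
  have e₅ := h c₅
  have e₆ := h c₆
  have e₇ := h c₇
  have e₉ := h c₉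
  have e₁₁ := h c₁₁
  omega

/-- The stages are chained with one word length `w` throughout, and each contributes at most a
constant times `(w + 1) ^ 3`, multiplied by the number of paths for the two path loops. -/
theorem runs_amplitudeProg {N : ℕ} (U : QCirc.Circuit N) (a b : QCirc.Bits N) :
    ∃ (x : List ℤ × (ℕ → ℤ)) (V V' : QCirc.Circuit N), U = V ++ V' ∧ V'.numH ≤ V.numH ∧
      V.numH ≤ V'.numH + 1 ∧
      Runs amplitudeProg (regs 0 0 0 0 0 0 0 0 0 0 0 0 0 0 0 0,
          fun n => (QCirc.encodeInput U a b).getD n 0) x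
        (timeConst * (N + U.length + 9) ^ 3 * (2 ^ V.numH + 8 * 2 ^ V'.numH + 1)) ∧
      ∀ j : Fin 4, x.1.getD j 0 =
        (QCirc.pairCount (List.reverse V') a (QCirc.pathCount V b (2 ^ V.numH))
          (8 * 2 ^ V'.numH) j : ℤ) -
        QCirc.pairCount (List.reverse V') a (QCirc.pathCount V b (2 ^ V.numH))
          (8 * 2 ^ V'.numH) (j + 4) := by
  set M : ℕ → ℤ := fun n => (QCirc.encodeInput U a b).getD n 0 with hMdef
  set m := U.length with hm
  -- Large enough for the encoded strings, for all addresses up to the counters, and for the pair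
  -- counts, which are at most `8 * 2 ^ h` with `h ≤ m`.
  obtain ⟨w, hw⟩ : ∃ w, w = N + m + 8 := ⟨_, rfl⟩
  obtain ⟨G, hG⟩ : ∃ G, G = 2 + N + N := ⟨_, rfl⟩
  obtain ⟨L, hL⟩ : ∃ L, L = G + 3 * m := ⟨_, rfl⟩
  obtain ⟨T, hT⟩ : ∃ T, T = L + N := ⟨_, rfl⟩
  have hbig : 16 * (N + m + 1) < 2 ^ w := by
    have h := Nat.lt_two_pow_self (n := N + m)
    rw [hw, pow_add]
    omega
  have h0 : len 0 ≤ w + 1 := Nat.le_add_left 1 w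
  have hMlen (n : ℕ) : len (M n) ≤ w + 1 := by
    rcases lt_or_ge n (QCirc.encodeInput U a b).length with hn | hn
    · simp only [hMdef]
      rw [List.getD_eq_getElem _ _ hn]
      have := QCirc.abs_le_of_mem_encodeInput U a b (List.getElem_mem hn)
      refine len_le_iff.2 (this.trans_lt ?_)
      exact_mod_cast (show N + U.length + 2 < 2 ^ w by omega)
    · simp only [hMdef]
      rw [List.getD_eq_default _ _ hn]
      exact h0
  have hpow (j : ℕ) (hj : j < w) : len (2 ^ j) ≤ w + 1 := len_le_iff.2 (by
    rw [abs_of_nonneg (by positivity)]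
    exact pow_lt_pow_right₀ one_lt_two hj)
  have hlen {n : ℕ} (hn : n ≤ 16 * (N + m + 1)) : len (n : ℤ) ≤ w + 1 :=
    len_le_of_nat_lt (hn.trans_lt hbig)
  have hbits (j : ℕ) (hj : j < N) : (0 ≤ M (2 + j) ∧ M (2 + j) ≤ 1) ∧
      (0 ≤ M (2 + N + j) ∧ M (2 + N + j) ≤ 1) := by
    have h1 : M (2 + j) = _ := QCirc.getD_encodeInput_left U a b ⟨j, hj⟩
    have h2 : M (2 + N + j) = _ := QCirc.getD_encodeInput_right U a b ⟨j, hj⟩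
    have h3 := (a ⟨j, hj⟩).isLt
    have h4 := (b ⟨j, hj⟩).isLt
    omega
  have hA : binary (fun j => M (2 + j)) N = QCirc.enc a :=
    binary_eq_enc a (QCirc.getD_encodeInput_left U a b)
  have hB : binary (fun j => M (2 + N + j)) N = QCirc.enc b :=
    binary_eq_enc b (QCirc.getD_encodeInput_right U a b)
  have hlenEnc (s : QCirc.Bits N) : len (QCirc.enc s : ℤ) ≤ w + 1 :=
    len_le_of_nat_lt ((QCirc.enc_lt s).trans_le (Nat.pow_le_pow_right two_pos (by omega)))
  set base := withPowers M L N with hbase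
  have hbaselen (n : ℕ) : len (base n) ≤ w + 1 := by
    rw [hbase, withPowers]
    split_ifs with h
    · exact hpow _ (by omega)
    · exact hMlen n
  -- Memory beyond the input is `0` initially and the powers of two end at `T`, so the counters and
  -- the table need no initialization.
  have hlay : base = lay T base (fun _ => 0) (fun _ => 0) := by
    funext n
    simp only [lay]
    split_ifs with h1 h2
    · rfl
    all_goals
      rw [hbase, withPowers, if_neg (by omega), hMdef]
      exact List.getD_eq_default _ _ (by rw [QCirc.length_encodeInput]; omega)
  have hgate (g f : ℕ → ℕ) (k : ℕ) (hk : k < U.length) :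
      GateAt (lay T base g f) ((G + 3 * k : ℕ) : ℤ) U[k] := by
    rw [hG]
    refine gateAt_encodeInput U a b (fun n hn => ?_) k hk
    rw [lay, if_pos (by omega), hbase, withPowers, if_neg (by omega)]
  have hregs (z addr cnt d x A B Y X p : ℤ) (hz : len z ≤ w + 1) (haddr : len addr ≤ w + 1)
      (hcnt : len cnt ≤ w + 1) (hd : len d ≤ w + 1) (hx : len x ≤ w + 1) (hA : len A ≤ w + 1)
      (hB : len B ≤ w + 1) (hY : len Y ≤ w + 1) (hX : len X ≤ w + 1) (hp : len p ≤ w + 1) :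
      Bounded (w + 1) (regs 0 0 z addr cnt d L x A B Y X p m T G, base) := by
    refine .of_regs (Nat.le_add_left 1 w) hbaselen ?_
    simp only [List.forall_mem_cons, List.not_mem_nil, false_imp_iff, implies_true, and_true]
    exact ⟨h0, h0, hz, haddr, hcnt, hd, hlen (by omega), hx, hA, hB, hY, hX, hp,
      hlen (by omega), hlen (by omega), hlen (by omega)⟩
  have r1 := Runs.straight (P := setup) (n := 21) (by decide) rfl (Nat.le_add_left 1 w)
    (.of_regs (Nat.le_add_left 1 w) hMlen (by simpa using h0))
    (eval_setup (M := M) (N := N) (m := m) (by simp [hMdef, QCirc.encodeInput_eq])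
      (by simp [hMdef, QCirc.encodeInput_eq, hm]))
  have eG : (2 : ℤ) + N + N = G := by rw [hG]; push_cast; rfl
  have eL : (G : ℤ) + 3 * m = L := by rw [hL]; push_cast; rfl
  have eT : (L : ℤ) + N = T := by rw [hT]; push_cast; rfl
  rw [eG, eL, eT] at r1
  have r2 : Runs (.loop 8 bitsBody) (regs 0 0 L 2 N 0 L 0 0 0 1 N 0 m T G, M)
      (regs 0 0 ((L + N : ℕ) : ℤ) ((2 + N : ℕ) : ℤ) 0 0 L 0 (QCirc.enc a) (QCirc.enc b) (2 ^ N) N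
        0 m T G, base) (N * (w + 1 + bitsBody.costFactor * (w + 1) ^ 2) + (w + 1)) := by
    have h := runs_bitsLoop (M := M) (L := L) (N := N) (w := w) (m := m) (T := T) (G := G)
      (by omega) (by omega) (by omega) (hlen (by omega)) (hlen (by omega)) (hlen (by omega)) hMlen
      (fun j hj => (hbits j hj).1) (fun j hj => (hbits j hj).2) N 0 (zero_add N)
    have hM0 : withPowers M L 0 = M := by
      funext n
      exact if_neg (by omega)
    rw [hM0, hA, hB] at h
    exact h
  have r3 := Runs.straight (P := countStart) (n := 21)
    (y := (regs 0 0 0 G m 0 L 0 (QCirc.enc a) (QCirc.enc b) (2 ^ N) 1 0 m T G, base))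
    (by decide) rfl (Nat.le_add_left 1 w)
    (hregs ((L + N : ℕ) : ℤ) ((2 + N : ℕ) : ℤ) 0 0 0 (QCirc.enc a) (QCirc.enc b) (2 ^ N) N 0
      (hlen (by omega)) (hlen (by omega)) h0 h0 h0 (hlenEnc a) (hlenEnc b) (hpow N (by omega))
      (hlen (by omega)) h0) (by simp [countStart, block, Prog.eval])
  have hgate' (k : ℕ) (hk : k < U.length) : GateAt base (G + 3 * k) U[k] := by
    have h := hgate (fun _ => 0) (fun _ => 0) k hk
    rw [← hlay] at h
    exact_mod_cast h
  have r4 := runs_countLoop (w := w) (M := base) (L := L) (A := QCirc.enc a) (B := QCirc.enc b)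
    (Y := 2 ^ N) (p := 0) (m := m) (T := T) (G := G)
    (fun addr haddr cnt hcnt X hX => hregs 0 addr cnt 0 0 _ _ _ X 0 h0 haddr hcnt h0 h0 (hlenEnc a)
      (hlenEnc b) (hpow N (by omega)) hX h0) U G 0 (by omega) (by omega) hgate'
  rw [zero_add, pow_zero] at r4
  have hH := U.numH_le
  have r5 := Runs.straight (P := splitStart) (n := 21)
    (y := ((regs 0 0 0 G 0 0 L 0 (QCirc.enc a) (QCirc.enc b) (2 ^ 0) (2 ^ U.numH) (0 : ℕ) m T
      G).set 0 (2 ^ U.numH - 2 ^ 0), base))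
    (by decide) rfl (Nat.le_add_left 1 w)
    (hregs 0 ((G + 3 * U.length : ℕ) : ℤ) 0 0 0 (QCirc.enc a) (QCirc.enc b) (2 ^ N) (2 ^ U.numH) 0
      h0 (hlen (by omega)) h0 h0 h0 (hlenEnc a) (hlenEnc b) (hpow N (by omega))
      (hpow _ (by omega)) h0) (by simp [splitStart, block, Prog.eval, Op.eval])
  obtain ⟨V, V', addr', v, hUV, hV', hV, haddr', hv, r6⟩ := runs_splitLoop (w := w) (M := base)
    (L := L) (A := QCirc.enc a) (B := QCirc.enc b) (m := m) (T := T) (G := G)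
    (fun addr haddr Y hY X hX p hp => hregs 0 addr 0 0 0 _ _ Y X p h0 haddr h0 h0 h0 (hlenEnc a)
      (hlenEnc b) hY hX hp) U G 0 0 (by omega) (by omega) (by omega) (Nat.zero_le _) hgate'
  rw [zero_add] at hV' hV
  rw [zero_add, zero_add] at r6
  have hmV : m = V.length + V'.length := by rw [hm, hUV, List.length_append]
  have hVH := V.numH_le
  have hVH' := V'.numH_le
  have lenH := hpow V.numH (by omega)
  have lenH' := hpow V'.numH (by omega)
  have len8 : len (8 * 2 ^ V'.numH) ≤ w + 1 := by
    rw [show (8 : ℤ) = 2 ^ 3 by norm_num, ← pow_add]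
    exact hpow _ (by omega)
  have lenp : len (V.length : ℤ) ≤ w + 1 := hlen (by omega)
  have r7 := Runs.straight (P := forwardInit) (n := 21)
    (y := (regs 0 0 0 0 0 0 L ((2 ^ V.numH : ℕ) : ℤ) (QCirc.enc a) (QCirc.enc b) (2 ^ V.numH)
      (2 ^ V'.numH) V.length m T G, lay T base (fun _ => 0) (fun _ => 0)))
    (by decide) rfl (Nat.le_add_left 1 w)
    ((hregs 0 addr' 0 0 0 (QCirc.enc a) (QCirc.enc b) (2 ^ V.numH) (2 ^ V'.numH) V.length
      h0 haddr' h0 h0 h0 (hlenEnc a) (hlenEnc b) lenH lenH' lenp).set hv 0)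
    (by rw [← hlay]; simp [forwardInit, block, Prog.eval])
  have hkV {n k : ℕ} (hn : n + k < w) : (2 : ℕ) ^ n * 2 ^ k < 2 ^ w := by
    rw [← pow_add]
    exact Nat.pow_lt_pow_right one_lt_two hn
  have hVw : 2 ^ V.numH < 2 ^ w := Nat.pow_lt_pow_right one_lt_two (by omega)
  have r8 := runs_forwardLoop (w := w) (T := T) (base := base) (L := L) (A := QCirc.enc a)
    (Y := 2 ^ V.numH) (X := 2 ^ V'.numH) (m := m) (g := fun _ => 0) (G := G) b V
    (fun f => powersAt_lay (by omega) M _ f) (by omega) (by omega)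
    (fun x hx d hd => hregs 0 0 0 d x _ _ _ _ _ h0 h0 h0 hd hx (hlenEnc a) (hlenEnc b) lenH lenH'
      lenp) (by omega)
    (fun f k hk => by
      have h := hgate (fun _ => 0) f k (by omega)
      simp only [hUV, List.getElem_append_left hk] at h
      exact_mod_cast h)
    (fun q _ => by positivity) (2 ^ V.numH) (fun _ => 0) (fun q => by rw [zero_add]; exact hVw)
  simp only [zero_add] at r8
  set f := QCirc.pathCount V b (2 ^ V.numH) with hf
  have hfle (q : ℕ) : f q ≤ 2 ^ V.numH := by
    rw [hf, QCirc.pathCount]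
    refine (Finset.sum_le_card_nsmul _ _ 1 fun x _ => ?_).trans (by simp)
    split_ifs <;> omega
  have hflen (q : ℕ) : f q < 2 ^ w := (hfle q).trans_lt hVw
  have r9 := Runs.straight (P := backwardInit) (n := 21)
    (y := (regs 0 0 0 0 0 0 L ((8 * 2 ^ V'.numH : ℕ) : ℤ) (QCirc.enc a) (QCirc.enc b) 0
      (2 ^ V'.numH) (List.reverse V').length m T G, lay T base (fun _ => 0) f))
    (by decide) rfl (Nat.le_add_left 1 w)
    ((hregs 0 0 0 0 0 (QCirc.enc a) (QCirc.enc b) (2 ^ V.numH) (2 ^ V'.numH) V.length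
      h0 h0 h0 h0 h0 (hlenEnc a) (hlenEnc b) lenH lenH' lenp).lay (T := T) (g := fun _ => 0)
      (fun q _ => by positivity) hflen)
    (by
      have e : (m : ℤ) - V.length = V'.length := by rw [hmV]; push_cast; ring
      simp [backwardInit, block, Prog.eval, Op.eval, e])
  obtain ⟨g, r10, hg, hgq⟩ := runs_backwardLoop (w := w) (T := T) (base := base) (L := L)
    (B := QCirc.enc b) (X := 2 ^ V'.numH) (m := m) (G := G) (f := f) (K := 2 ^ V.numH) a
    (List.reverse V')
    (fun g => powersAt_lay (by omega) M g f) (by omega) (by omega)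
    (fun x hx d hd r hr => hregs 0 0 0 d x _ _ r _ _ h0 h0 h0 hd hx (hlenEnc a) (hlenEnc b) hr
      lenH' (by rw [List.length_reverse]; exact hlen (by omega)))
    (by
      rw [List.length_reverse]
      have h1 : |(L : ℤ) - 3| ≤ L + 3 := abs_le.2 ⟨by omega, by omega⟩
      have h2 : ((L + 3 + 3 * V'.length : ℕ) : ℤ) < 2 ^ w := by
        exact_mod_cast (show L + 3 + 3 * V'.length < 2 ^ w by omega)
      push_cast at h2
      omega)
    (by rw [List.length_reverse]; omega)
    (fun g k hk => by
      rw [List.length_reverse] at hk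
      -- Gate `k` of the reversed second part, counted from the start of the whole circuit.
      have h := hgate g f (V.length + (V'.length - 1 - k)) (by omega)
      simp only [hUV] at h
      rw [List.getElem_append_right (by omega)] at h
      simp only [Nat.add_sub_cancel_left] at h
      rw [List.getElem_reverse]
      convert h using 1
      omega)
    hfle hVw (8 * 2 ^ V'.numH) (by
      rw [show 8 = 2 ^ 3 by norm_num]
      -- The counters are bounded by the number of rounds times the largest table entry, `8 * 2 ^
      -- V'.numH * 2 ^ V.numH`; the exponents add up to at most `m + 3`.
      exact hkV (by omega)) (fun _ => 0) (fun q _ => by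
      rw [show 8 = 2 ^ 3 by norm_num, ← pow_add, zero_add]
      exact hkV (by rw [hUV, QCirc.Circuit.numH_append] at hH; omega))
  simp only [zero_add] at hgq
  have r11 := Runs.straight (P := output) (n := 21) (by decide) rfl (Nat.le_add_left 1 w)
    ((hregs 0 0 0 0 0 (QCirc.enc a) (QCirc.enc b) 0 (2 ^ V'.numH) (List.reverse V').length
      h0 h0 h0 h0 h0 (hlenEnc a) (hlenEnc b) h0 lenH'
      (by rw [List.length_reverse]; exact hlen (by omega))).lay (T := T) hg hflen) rfl
  refine ⟨_, V, V', hUV, hV', hV, (r1.seq (r2.seq (r3.seq (r4.seq (r5.seq (r6.seq (r7.seq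
    (r8.seq (r9.seq (r10.seq r11)))))))))).mono ?_, fun j => ?_⟩
  · have hW : N + U.length + 9 = w + 1 := by omega
    rw [hW]
    have hW1 : 1 ≤ w + 1 := Nat.le_add_left 1 w
    have hm' : U.length ≤ w + 1 := by omega
    have t2 := loopTime_le (c := bitsBody.costFactor) (show N ≤ w + 1 by omega) hW1
    have t4 := loopTime_le (c := countBody.costFactor) hm' hW1
    have t6 := loopTime_le (c := splitBody.costFactor) hm' hW1
    have t8 := pathLoopTime_le (P := forwardStart) (Q := forwardEnd) (n := V.length)
      (k := 2 ^ V.numH) (show _ ≤ w + 1 by omega) hW1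
    have t10 := pathLoopTime_le (P := backwardStart) (Q := backwardEnd)
      (n := (List.reverse V').length) (k := 8 * 2 ^ V'.numH)
      (show _ ≤ w + 1 by rw [List.length_reverse]; omega) hW1
    have hsq : (w + 1) ^ 2 ≤ (w + 1) ^ 3 := Nat.pow_le_pow_right hW1 (by norm_num)
    have hs (c : ℕ) : c * (w + 1) ^ 2 ≤ c * (w + 1) ^ 3 := Nat.mul_le_mul_left c hsq
    refine (time_sum_le (hs _) t2 (hs _) t4 (hs _) t6 (hs _) t8 (hs _) t10 (hs _)).trans ?_
    refine Nat.mul_le_mul_right _ (Nat.mul_le_mul_right _ ?_)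
    rw [timeConst]
    omega
  · rw [eval_output, hgq, hgq]

end RAM

/-! ### From the running time to the stated bound. -/

/-- A product `E * 2 ^ (h / 2)` is bounded by `2 ^ (0.984965 h)` if `E` is small against `2 ^ h`, and by
`E ^ 3` otherwise. -/
theorem mul_two_rpow_half_le {E : ℝ} (hE : 0 ≤ E) (h : ℕ) :
    E * (2 : ℝ) ^ ((h : ℝ) / 2) ≤ (2 : ℝ) ^ ((0.984965 : ℝ) * (h : ℝ)) + E ^ 3 := by
  have hh : (0 : ℝ) ≤ h := h.cast_nonneg
  have hpos (x : ℝ) : 0 < (2 : ℝ) ^ x := Real.rpow_pos_of_pos two_pos x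
  rcases le_total E ((2 : ℝ) ^ ((0.4 : ℝ) * h)) with hle | hge
  · calc E * (2 : ℝ) ^ ((h : ℝ) / 2)
        ≤ (2 : ℝ) ^ ((0.4 : ℝ) * h) * (2 : ℝ) ^ ((h : ℝ) / 2) :=
          mul_le_mul_of_nonneg_right hle (hpos _).le
      _ = (2 : ℝ) ^ ((0.4 : ℝ) * h + (h : ℝ) / 2) := (Real.rpow_add two_pos _ _).symm
      _ ≤ (2 : ℝ) ^ ((0.984965 : ℝ) * (h : ℝ)) :=
          Real.rpow_le_rpow_of_exponent_le one_le_two (by linarith)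
      _ ≤ _ := le_add_of_nonneg_right (pow_nonneg hE 3)
  · have h1 : (2 : ℝ) ^ ((h : ℝ) / 2) ≤ E ^ 2 :=
      calc (2 : ℝ) ^ ((h : ℝ) / 2) ≤ (2 : ℝ) ^ ((0.4 : ℝ) * h + (0.4 : ℝ) * h) :=
            Real.rpow_le_rpow_of_exponent_le one_le_two (by linarith)
        _ = ((2 : ℝ) ^ ((0.4 : ℝ) * h)) ^ 2 := by rw [Real.rpow_add two_pos, sq]
        _ ≤ E ^ 2 := pow_le_pow_left₀ (hpos _).le hge 2
    calc E * (2 : ℝ) ^ ((h : ℝ) / 2) ≤ E * E ^ 2 := mul_le_mul_of_nonneg_left h1 hE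
      _ = E ^ 3 := by ring
      _ ≤ _ := le_add_of_nonneg_left (hpos _).le

/-- The smaller part satisfies `h₂ ≤ (h₁ + h₂) / 2`, and the larger one exceeds it by at most one.
The sum is at most `(2 + 8 + 1) * 2 ^ h₂`, so 20 is a generous constant. -/
theorem two_pow_add_le {h₁ h₂ : ℕ} (h : h₂ ≤ h₁) (h' : h₁ ≤ h₂ + 1) :
    ((2 ^ h₁ + 8 * 2 ^ h₂ + 1 : ℕ) : ℝ) ≤ 20 * (2 : ℝ) ^ (((h₁ + h₂ : ℕ) : ℝ) / 2) := by
  have h1 : (2 ^ h₁ + 8 * 2 ^ h₂ + 1 : ℕ) ≤ 11 * 2 ^ h₂ := by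
    have h3 : 2 ^ h₁ ≤ 2 ^ (h₂ + 1) := Nat.pow_le_pow_right two_pos h'
    have h4 : 1 ≤ 2 ^ h₂ := Nat.one_le_two_pow
    rw [pow_succ] at h3
    omega
  have h2 : (2 : ℝ) ^ h₂ ≤ (2 : ℝ) ^ (((h₁ + h₂ : ℕ) : ℝ) / 2) := by
    rw [← Real.rpow_natCast]
    refine Real.rpow_le_rpow_of_exponent_le one_le_two ?_
    have h3 : (h₂ : ℝ) ≤ h₁ := by exact_mod_cast h
    push_cast
    linarith
  have h3 : ((2 ^ h₁ + 8 * 2 ^ h₂ + 1 : ℕ) : ℝ) ≤ 11 * 2 ^ h₂ := by exact_mod_cast h1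
  have h4 : (0 : ℝ) < 2 ^ h₂ := by positivity
  linarith

theorem theorem11 :
    ∃ (P : RAM.Prog) (poly : Polynomial ℕ) (ε : ℕ → ℝ),
      (ε =o[atTop] fun h : ℕ => (h : ℝ)) ∧
      ∀ (N : ℕ) (U : QCirc.Circuit N) (a b : QCirc.Bits N),
        ∃ (t : ℕ) (s : RAM.State),
          RAM.Exec P (RAM.State.init (QCirc.encodeInput U a b)) t s ∧
          (t : ℝ) ≤ (2 : ℝ) ^ ((0.984965 : ℝ) * (U.numH : ℝ) + ε U.numH)
            + ((poly.eval (N + U.length) : ℕ) : ℝ) ∧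
          U.amplitude a b =
            (∑ j : Fin 4, ((s.reg j : ℤ) : ℂ) * QCirc.omega ^ (j : ℕ)) /
              ((Real.sqrt 2 : ℝ) : ℂ) ^ U.numH := by
  -- Only the fact that this is a constant matters, so its value is hidden behind a variable.
  obtain ⟨c, hc⟩ : ∃ c, RAM.timeConst = c := ⟨_, rfl⟩
  refine ⟨RAM.amplitudeProg,
    -- The cube of the `E` set below, as it appears in `mul_two_rpow_half_le`.
    (Polynomial.C (20 * c) * (Polynomial.X + Polynomial.C 9) ^ 3) ^ 3, fun _ => 0,
    isLittleO_zero _ _, fun N U a b => ?_⟩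
  obtain ⟨x, V, V', hU, hV', hV, ⟨t, ht, hrun⟩, hx⟩ := RAM.runs_amplitudeProg U a b
  rw [hc] at ht
  refine ⟨t, RAM.State.mk' x, ?_, ?_, ?_⟩
  · have hinit : RAM.State.init (QCirc.encodeInput U a b) =
        RAM.State.mk' (List.replicate 21 0, fun n => (QCirc.encodeInput U a b).getD n 0) := by
      simp only [RAM.State.init, RAM.State.mk', RAM.State.mk.injEq, and_true]
      funext i
      rw [List.getD_eq_getElem?_getD, List.getElem?_replicate]
      split_ifs <;> rfl
    rw [hinit]
    exact hrun
  · have hH : U.numH = V.numH + V'.numH := by rw [hU, QCirc.Circuit.numH_append]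
    set E : ℝ := 20 * c * ((N : ℝ) + U.length + 9) ^ 3 with hE
    have hE0 : 0 ≤ E := by positivity
    have h1 : (t : ℝ) ≤ ((c * (N + U.length + 9) ^ 3 *
        (2 ^ V.numH + 8 * 2 ^ V'.numH + 1) : ℕ) : ℝ) := by exact_mod_cast ht
    have h2 := two_pow_add_le hV' hV
    have h3 := mul_two_rpow_half_le hE0 U.numH
    rw [← hH] at h2
    rw [Nat.cast_mul] at h1
    have h4 := mul_le_mul_of_nonneg_left h2
      (Nat.cast_nonneg (α := ℝ) (c * (N + U.length + 9) ^ 3))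
    refine h1.trans (h4.trans ?_)
    rw [add_zero]
    refine (le_of_eq ?_).trans (h3.trans (le_of_eq ?_))
    · rw [hE]
      push_cast
      ring
    · rw [hE]
      simp
  · subst hU
    rw [QCirc.amplitude_append V V' a b (fun q => QCirc.pairCount (List.reverse V') a
      (QCirc.pathCount V b (2 ^ V.numH)) (8 * 2 ^ V'.numH) q) fun _ => rfl]
    congr 1
    refine Finset.sum_congr rfl fun j _ => ?_
    have := hx j
    change (RAM.State.mk' x).reg j = _ at this
    rw [this]
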